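/- Let $U_q=U_q(sl_2)$ be the $\mathbb C(q)$-algebra with generators $K^{\pm1},E,F$ and relations $KK^{-1}=K^{-1}K=1$, $KE=q^2EK$, $KF=q^{-2}FK$, $EF-FE=\frac{K-K^{-1}}{q-q^{-1}}$. Put $[2]=q+q^{-1}$. Let $V_2$ be the representation with basis $v_2,v_0,v_{-2}$ and $Ev_2=0$, $Ev_0=[2]v_2$, $Ev_{-2}=v_0$, $Fv_2=v_0$, $Fv_0=[2]v_{-2}$, $Fv_{-2}=0$, $Kv_i=q^iv_i$, and put $v^{\pm2}=v_{\pm2}$, $v^0=[2]^{-1}v_0$. Let $U_q$ act on $V_2^{\otimes n}$ through the comultiplication $\bar\Delta(E)=E\otimes1+K^{-1}\otimes E$, $\bar\Delta(F)=F\otimes K+1\otimes F$, $\bar\Delta(K)=K\otimes K$, and let $\mathrm{Inv}_{U_q}(V_2^{\otimes n})$ be the space of vectors on which $U_q$ acts by the counit ($E,F\mapsto0$, $K^{\pm 1}\mapsto1$). Let $V_1$ be the space with basis $v^1,v^{-1}$. Define $\delta_1:\mathbb C(q)\to V_1^{\otimes2}$ by $\delta_1(1)=v^1\otimes v^{-1}-q^{-1}v^{-1}\otimes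 v^1$ and write $(\delta_1)^k_l=1^{\otimes l}\otimes\delta_1\otimes1^{\otimes(k-l)}$. Define $\pi_2:V_1^{\otimes2}\to V_2$ by $v^1\otimes v^1\mapsto v^2$, $v^1\otimes v^{-1}\mapsto q^{-1}v^0$, $v^{-1}\otimes v^1\mapsto v^0$, $v^{-1}\otimes v^{-1}\mapsto v^{-2}$. Define the Jones–Wenzl projector $p_2$ on $V_1^{\otimes2}$ by $p_2(v^{\pm1}\otimes v^{\pm1})=v^{\pm1}\otimes v^{\pm1}$, $p_2(v^1\otimes v^{-1})=\frac1{[2]}(q^{-1}v^1\otimes v^{-1}+v^{-1}\otimes v^1)$, $p_2(v^{-1}\otimes v^1)=\frac1{[2]}(v^1\otimes v^{-1}+q\,v^{-1}\otimes v^1)$. The Frenkel–Khovanov dual canonical basis $\mathfrak B^0_n$ of $\mathrm{Inv}_{U_q}(V_2^{\otimes n})$ consists of the nonzero images under $\pi_2^{\otimes n}$ of the elements $(\delta_1)^{2(n-1)}_{i_{n-1}}\cdots(\delta_1)^2_{i_1}(\delta_1)^0_0(1)\in V_1^{\otimes 2n}$ with $0\le i_j\le j$ (of the element $1$ if $n=0$).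 A Riordan tree $T$ of order $n$ is determined by a non-crossing partition of $\{1,\dots,n\}$ into parts with at least two elements. The part $i_1<\dots<i_k$ carries the linear trivalent tree with leaves $i_1,\dots,i_k$ in this order: a single edge if $k=2$, and a chain of $k-2$ trivalent vertices joined by $k-3$ internal edges if $k\ge3$. Embed $T$ in the lower half-plane with leaf $j$ at the point $(j,0)$, and put at each such point a box $\pi_2$ with two strands, a left one and a right one. The boundary of an annular neighbourhood of $T$ is a union of disjoint arcs joining these strands: for each part, the right strand of $i_a$ is joined to the left strand of $i_{a+1}$ for $1\le a<k$, and the left strand of $i_1$ to the right strand of $i_k$. Let $f^0(T)\in V_2^{\otimes n}$ be the value of this diagram, each arc standing for $\delta_1$. Let $f(T)$ be the value of the diagram obtained by inserting a copy of $p_2$, for each internal edge of $T$, in the pair of arcs running along that edge. **Theorem.** For every $n\ge0$, the elements $f^0(T)$, with $T$ running over the Riordan trees of order $n$, are exactly the elements of $\mathfrak B^0_n$, and they form a basis of $\mathrm{Inv}_{U_q}(V_2^{\otimes n})$ over $\mathbb C(q)$ indexed by $T$. The elements $f(T)$ also form a basis of $\mathrm{Inv}_{U_q}(V_2^{\otimes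 n})$ indexed by $T$, and this basis is unitriangular with respect to $\mathfrak B^0_n$: for some linear order on the Riordan trees of order $n$, each $f(T)$ is the sum of $f^0(T)$ and a $\mathbb C(q)$-linear combination of elements $f^0(T')$ with $T'<T$. -/

import Mathlib

open scoped TensorProduct

namespace QuantumTree

noncomputable section

/-- The ground field `ℂ(q)`. -/
abbrev Cq : Type := RatFunc ℂ

/-- The indeterminate `q`. -/
def q : Cq := RatFunc.X

/-- The quantum integer `[2] = (q² - q⁻²)/(q - q⁻¹)`. -/
def qTwo : Cq := (q ^ 2 - (q ^ 2)⁻¹) / (q - q⁻¹)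

theorem q_ne_zero : q ≠ 0 := RatFunc.X_ne_zero

theorem q_sq_ne_one : q ^ 2 ≠ 1 := by
  intro h
  have h1 : algebraMap (Polynomial ℂ) (RatFunc ℂ) (Polynomial.X ^ 2) =
      algebraMap (Polynomial ℂ) (RatFunc ℂ) 1 := by
    simpa [q, RatFunc.algebraMap_X] using h
  have h2 := RatFunc.algebraMap_injective ℂ h1
  have h3 := congrArg Polynomial.natDegree h2
  simp at h3

theorem q_sub_inv_ne_zero : q - q⁻¹ ≠ 0 := by
  intro h
  apply q_sq_ne_one
  have h1 : q = q⁻¹ := sub_eq_zero.mp h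
  calc q ^ 2 = q * q := sq q
    _ = q * q⁻¹ := by rw [← h1]
    _ = 1 := mul_inv_cancel₀ q_ne_zero

/-! ### The quantum group -/

/-- Generators of `U_q(sl₂)`; `Kinv` stands for `K⁻¹`. -/
inductive UqGen : Type
  | E | F | K | Kinv

/-- A generator as an element of the free algebra. -/
abbrev gen (x : UqGen) : FreeAlgebra Cq UqGen := FreeAlgebra.ι Cq x

/-- Defining relations of `U_q(sl₂)`. -/
inductive UqRel : FreeAlgebra Cq UqGen → FreeAlgebra Cq UqGen → Prop
  | K_Kinv : UqRel (gen .K * gen .Kinv) 1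
  | Kinv_K : UqRel (gen .Kinv * gen .K) 1
  | K_E : UqRel (gen .K * gen .E) (q ^ 2 • (gen .E * gen .K))
  | K_F : UqRel (gen .K * gen .F) ((q ^ 2)⁻¹ • (gen .F * gen .K))
  | E_F : UqRel (gen .E * gen .F - gen .F * gen .E) ((q - q⁻¹)⁻¹ • (gen .K - gen .Kinv))

/-- The algebra `U_q = U_q(sl₂)` over `ℂ(q)`. -/
abbrev Uq : Type := RingQuot UqRel

/-- A generator as an element of `U_q`. -/
def uq (x : UqGen) : Uq := RingQuot.mkAlgHom Cq UqRel (gen x)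

theorem uq_K_Kinv : uq .K * uq .Kinv = 1 := by
  simpa [uq] using RingQuot.mkAlgHom_rel Cq UqRel.K_Kinv

theorem uq_Kinv_K : uq .Kinv * uq .K = 1 := by
  simpa [uq] using RingQuot.mkAlgHom_rel Cq UqRel.Kinv_K

theorem uq_K_E : uq .K * uq .E = q ^ 2 • (uq .E * uq .K) := by
  simpa only [uq, map_mul, map_smul] using RingQuot.mkAlgHom_rel Cq UqRel.K_E

theorem uq_K_F : uq .K * uq .F = (q ^ 2)⁻¹ • (uq .F * uq .K) := by
  simpa only [uq, map_mul, map_smul] using RingQuot.mkAlgHom_rel Cq UqRel.K_F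

theorem uq_E_F : uq .E * uq .F - uq .F * uq .E = (q - q⁻¹)⁻¹ • (uq .K - uq .Kinv) := by
  simpa only [uq, map_mul, map_smul, map_sub] using RingQuot.mkAlgHom_rel Cq UqRel.E_F

/-- The algebra homomorphism out of `U_q` given by images of the generators that satisfy the
defining relations. -/
def uqLift {A : Type} [Ring A] [Algebra Cq A] (g : UqGen → A)
    (h1 : g .K * g .Kinv = 1) (h2 : g .Kinv * g .K = 1)
    (h3 : g .K * g .E = q ^ 2 • (g .E * g .K))
    (h4 : g .K * g .F = (q ^ 2)⁻¹ • (g .F * g .K))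
    (h5 : g .E * g .F - g .F * g .E = (q - q⁻¹)⁻¹ • (g .K - g .Kinv)) : Uq →ₐ[Cq] A :=
  RingQuot.liftAlgHom Cq ⟨FreeAlgebra.lift Cq g, by
    intro x y hxy
    cases hxy <;> simp only [gen, map_mul, map_sub, map_smul, map_one, FreeAlgebra.lift_ι_apply]
    · exact h1
    · exact h2
    · exact h3
    · exact h4
    · exact h5⟩

theorem uqLift_uq {A : Type} [Ring A] [Algebra Cq A] (g : UqGen → A) (h1 h2 h3 h4 h5)
    (x : UqGen) : uqLift g h1 h2 h3 h4 h5 (uq x) = g x := by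
  simp [uqLift, uq, gen]

/-- The counit: `E, F ↦ 0`, `K^{±1} ↦ 1`. -/
def counit : Uq →ₐ[Cq] Cq :=
  uqLift (fun x => match x with | .E => 0 | .F => 0 | .K => 1 | .Kinv => 1)
    (by simp) (by simp) (by simp) (by simp) (by simp)

/-- Values on the generators of the comultiplication `Δ̄ = (σ ⊗ σ) ∘ Δ ∘ σ`, where
`Δ E = E ⊗ 1 + K ⊗ E`, `Δ F = F ⊗ K⁻¹ + 1 ⊗ F`, `Δ K = K ⊗ K`, and `σ` is the bar involution
(`E ↦ E`, `F ↦ F`, `K ↦ K⁻¹`, `q ↦ q⁻¹`). This is the comultiplication through which `U_q` acts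
on tensor products carrying dual canonical bases. -/
def comulGen : UqGen → Uq ⊗[Cq] Uq
  | .E => uq .E ⊗ₜ 1 + uq .Kinv ⊗ₜ uq .E
  | .F => uq .F ⊗ₜ uq .K + 1 ⊗ₜ uq .F
  | .K => uq .K ⊗ₜ uq .K
  | .Kinv => uq .Kinv ⊗ₜ uq .Kinv

theorem uq_Kinv_E : uq .Kinv * uq .E = (q ^ 2)⁻¹ • (uq .E * uq .Kinv) := by
  have hq : (q ^ 2) ≠ 0 := pow_ne_zero _ q_ne_zero
  have h : uq .E * uq .Kinv = q ^ 2 • (uq .Kinv * uq .E) := by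
    calc uq .E * uq .Kinv = (uq .Kinv * uq .K) * uq .E * uq .Kinv := by
          rw [uq_Kinv_K, one_mul]
      _ = uq .Kinv * (uq .K * uq .E) * uq .Kinv := by simp only [mul_assoc]
      _ = q ^ 2 • (uq .Kinv * uq .E * (uq .K * uq .Kinv)) := by
          rw [uq_K_E]; simp only [mul_smul_comm, smul_mul_assoc, mul_assoc]
      _ = _ := by rw [uq_K_Kinv, mul_one]
  rw [h, smul_smul, inv_mul_cancel₀ hq, one_smul]

theorem uq_F_K : uq .F * uq .K = q ^ 2 • (uq .K * uq .F) := by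
  have hq : (q ^ 2) ≠ 0 := pow_ne_zero _ q_ne_zero
  rw [uq_K_F, smul_smul, mul_inv_cancel₀ hq, one_smul]

theorem comulGen_E_F : comulGen .E * comulGen .F - comulGen .F * comulGen .E =
    (q - q⁻¹)⁻¹ • (comulGen .K - comulGen .Kinv) := by
  have hq : (q ^ 2) ≠ 0 := pow_ne_zero _ q_ne_zero
  have e : (uq .Kinv * uq .F) ⊗ₜ[Cq] (uq .E * uq .K) =
      (uq .F * uq .Kinv) ⊗ₜ[Cq] (uq .K * uq .E) := by
    have h : uq .Kinv * uq .F = q ^ 2 • (uq .F * uq .Kinv) := by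
      calc uq .Kinv * uq .F = uq .Kinv * uq .F * (uq .K * uq .Kinv) := by
            rw [uq_K_Kinv, mul_one]
        _ = uq .Kinv * (uq .F * uq .K) * uq .Kinv := by simp only [mul_assoc]
        _ = q ^ 2 • ((uq .Kinv * uq .K) * uq .F * uq .Kinv) := by
            rw [uq_F_K]; simp only [mul_smul_comm, smul_mul_assoc, mul_assoc]
        _ = _ := by rw [uq_Kinv_K, one_mul]
    rw [h, uq_K_E, TensorProduct.smul_tmul]
  have hEF : uq .E * uq .F = uq .F * uq .E + (q - q⁻¹)⁻¹ • (uq .K - uq .Kinv) := by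
    rw [← uq_E_F]; abel
  simp only [comulGen, add_mul, mul_add, Algebra.TensorProduct.tmul_mul_tmul, one_mul, mul_one]
  rw [e, hEF]
  simp only [TensorProduct.add_tmul, TensorProduct.tmul_add, TensorProduct.tmul_smul,
    TensorProduct.sub_tmul, TensorProduct.tmul_sub, TensorProduct.smul_tmul', smul_sub]
  abel

/-- The comultiplication `Δ̄` of `U_q`. -/
def comul : Uq →ₐ[Cq] Uq ⊗[Cq] Uq :=
  uqLift comulGen
    (by simp [comulGen, uq_K_Kinv, Algebra.TensorProduct.one_def])
    (by simp [comulGen, uq_Kinv_K, Algebra.TensorProduct.one_def])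
    (by
      simp only [comulGen, add_mul, mul_add, Algebra.TensorProduct.tmul_mul_tmul, one_mul,
        mul_one, uq_K_E, uq_K_Kinv, uq_Kinv_K, smul_add, TensorProduct.tmul_smul,
        TensorProduct.smul_tmul'])
    (by
      simp only [comulGen, add_mul, mul_add, Algebra.TensorProduct.tmul_mul_tmul, one_mul,
        mul_one, uq_K_F, smul_add, TensorProduct.tmul_smul, TensorProduct.smul_tmul'])
    comulGen_E_F

/-- The underlying space of the 3-dimensional representation, with standard basis
`v₂, v₀, v₋₂` (indices `0, 1, 2`). -/
abbrev V2 : Type := Fin 3 → Cq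

/-- Matrices of the generators on `V₂` in the basis `v₂, v₀, v₋₂`:
`E v₀ = [2] v₂`, `E v₋₂ = v₀`, `F v₂ = v₀`, `F v₀ = [2] v₋₂`, `K v_i = q^i v_i`. -/
def V2mat : UqGen → Matrix (Fin 3) (Fin 3) Cq
  | .E => !![0, qTwo, 0; 0, 0, 1; 0, 0, 0]
  | .F => !![0, 0, 0; 1, 0, 0; 0, qTwo, 0]
  | .K => !![q ^ 2, 0, 0; 0, 1, 0; 0, 0, (q ^ 2)⁻¹]
  | .Kinv => !![(q ^ 2)⁻¹, 0, 0; 0, 1, 0; 0, 0, q ^ 2]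

/-- The 3-dimensional irreducible representation `V₂` of `U_q`. -/
def V2rep : Uq →ₐ[Cq] Module.End Cq V2 :=
  (Matrix.toLinAlgEquiv' (R := Cq) (n := Fin 3)).toAlgHom.comp <| uqLift V2mat
    (by
      have hq := q_ne_zero
      ext i j; fin_cases i <;> fin_cases j <;>
        simp [V2mat, Matrix.mul_apply, Fin.sum_univ_three, hq])
    (by
      have hq := q_ne_zero
      ext i j; fin_cases i <;> fin_cases j <;>
        simp [V2mat, Matrix.mul_apply, Fin.sum_univ_three, hq])
    (by
      have hq := q_ne_zero
      ext i j; fin_cases i <;> fin_cases j <;>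
        simp [V2mat, Matrix.mul_apply, Fin.sum_univ_three, hq])
    (by
      have hq := q_ne_zero
      ext i j; fin_cases i <;> fin_cases j <;>
        simp [V2mat, Matrix.mul_apply, Fin.sum_univ_three, hq, mul_comm])
    (by
      have hq := q_ne_zero
      ext i j; fin_cases i <;> fin_cases j <;>
        simp [V2mat, qTwo, div_eq_inv_mul, mul_sub])

/-- The tensor product of two representations, formed with `Δ̄`. -/
def tensorRep {M N : Type} [AddCommGroup M] [Module Cq M] [AddCommGroup N] [Module Cq N]
    (ρ : Uq →ₐ[Cq] Module.End Cq M) (σ : Uq →ₐ[Cq] Module.End Cq N) :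
    Uq →ₐ[Cq] Module.End Cq (M ⊗[Cq] N) :=
  Module.endTensorEndAlgHom.comp ((Algebra.TensorProduct.map ρ σ).comp comul)

/-- The tensor power `V₂^{⊗n}`. -/
abbrev V2Pow (n : ℕ) : Type := ⨂[Cq]^n V2

/-- The canonical isomorphism `V₂^{⊗n} ⊗ V₂ ≅ V₂^{⊗(n+1)}`. -/
def snocEquiv (n : ℕ) : V2Pow n ⊗[Cq] V2 ≃ₗ[Cq] V2Pow (n + 1) :=
  (TensorProduct.congr (LinearEquiv.refl Cq (V2Pow n))
    (PiTensorProduct.subsingletonEquiv (R := Cq) (s := fun _ : Fin 1 => V2) 0).symm).trans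
      TensorPower.mulEquiv

/-- The action of `U_q` on `V₂^{⊗n}`. -/
def powRep : (n : ℕ) → Uq →ₐ[Cq] Module.End Cq (V2Pow n)
  | 0 => (Algebra.ofId Cq (Module.End Cq (V2Pow 0))).comp counit
  | n + 1 => ((snocEquiv n).conjAlgEquiv Cq).toAlgHom.comp (tensorRep (powRep n) V2rep)

/-- The space `Inv_{U_q}(V₂^{⊗n})` of `U_q`-invariant tensors. -/
def Inv (n : ℕ) : Submodule Cq (V2Pow n) where
  carrier := {x | ∀ u : Uq, powRep n u x = counit u • x}
  add_mem' := by
    intro x y hx hy u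
    rw [map_add, hx u, hy u, smul_add]
  zero_mem' := by intro u; simp
  smul_mem' := by
    intro c x hx u
    rw [map_smul, hx u, smul_comm]

/-! ### Graphical calculus -/

/-- The 2-dimensional space `V₁` with standard basis `v¹, v⁻¹` (indices `0, 1`). -/
abbrev V1 : Type := Fin 2 → Cq

/-- The tensor power `V₁^{⊗m}`, attached to `m` strands. -/
abbrev V1Pow (m : ℕ) : Type := ⨂[Cq]^m V1

/-- The basis of `V₁^{⊗m}` consisting of the tensors `v^{±1} ⊗ ⋯ ⊗ v^{±1}`. -/
def V1basis (m : ℕ) : Module.Basis (Fin m → Fin 2) Cq (V1Pow m) :=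
  Basis.piTensorProduct (fun _ : Fin m => Pi.basisFun Cq (Fin 2))

/-- The map `(δ₁)_l^k = 1^{⊗l} ⊗ δ₁ ⊗ 1^{⊗(k-l)} : V₁^{⊗k} → V₁^{⊗(k+2)}`, where
`δ₁(1) = v¹ ⊗ v⁻¹ - q⁻¹ v⁻¹ ⊗ v¹`; it inserts an arc between two new strands in positions
`l`, `l + 1` (counted from `0`). -/
def cup (k : ℕ) (l : Fin (k + 1)) : V1Pow k →ₗ[Cq] V1Pow (k + 2) :=
  (V1basis k).constr Cq fun s =>
    V1basis (k + 2) (Fin.insertNth l.castSucc 0 (Fin.insertNth l 1 s : Fin (k + 1) → Fin 2))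
      - q⁻¹ • V1basis (k + 2)
          (Fin.insertNth l.castSucc 1 (Fin.insertNth l 0 s : Fin (k + 1) → Fin 2))

/-- Matrix coefficients of the Jones–Wenzl projector `p₂` on `V₁ ⊗ V₁`: `jw a b c d` is the
coefficient of `v^c ⊗ v^d` in `p₂ (v^a ⊗ v^b)`. -/
def jw : Fin 2 → Fin 2 → Fin 2 → Fin 2 → Cq
  | 0, 0, 0, 0 => 1
  | 1, 1, 1, 1 => 1
  | 0, 1, 0, 1 => qTwo⁻¹ * q⁻¹
  | 0, 1, 1, 0 => qTwo⁻¹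
  | 1, 0, 0, 1 => qTwo⁻¹
  | 1, 0, 1, 0 => qTwo⁻¹ * q
  | _, _, _, _ => 0

/-- The Jones–Wenzl projector `p₂` applied to the strands `i`, `j` (used with `j = i + 1`). -/
def jwAt {m : ℕ} (i j : Fin m) : V1Pow m →ₗ[Cq] V1Pow m :=
  (V1basis m).constr Cq fun s =>
    ∑ c : Fin 2, ∑ d : Fin 2,
      jw (s i) (s j) c d • V1basis m (Function.update (Function.update s i c) j d)

/-- The diagram without strands. -/
def emptyDiagram : V1Pow 0 := V1basis 0 Fin.elim0

/-- The boundary of an annular neighbourhood of the ordered linear tree with `k` leaves, as an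
element of `V₁^{⊗2k}`; leaf `a` carries the strands `2a` (left) and `2a+1` (right).
The arcs join the right strand of each leaf to the left strand of the next one, and the left strand
of the first leaf to the right strand of the last one. Passing from `k` to `k + 1` leaves splits the
end of the tree at the last leaf, which inserts an arc between its two strands. -/
def linTree₀ : (k : ℕ) → V1Pow (2 * k)
  | 0 => emptyDiagram
  | k + 1 => cup (2 * k) ⟨2 * k - 1, by omega⟩ (linTree₀ k)

/-- The same diagram with a copy of `p₂` inserted in the pair of arcs running along each internal
edge of the linear tree. When the edge leading to the last of `k ≥ 3` leaves is split, it becomes an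
edge joining two trivalent vertices and receives a `p₂` on its two strands; thus `k` leaves give
`k - 3` projectors, one for each internal edge (none for `k ≤ 3`). -/
def linTree : (k : ℕ) → V1Pow (2 * k)
  | 0 => emptyDiagram
  | k + 1 => cup (2 * k) ⟨2 * k - 1, by omega⟩
      (if h : 3 ≤ k then
        jwAt (⟨2 * k - 2, by omega⟩ : Fin (2 * k)) ⟨2 * k - 1, by omega⟩ (linTree k)
      else linTree k)

/-- Riordan trees of order `n`, given by the Riordan partition of `{1, …, n}` that determines them:
a non-crossing partition (the convex hulls of the parts are disjoint when the points are arranged on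
a circle) into parts with at least two elements. The component of the tree attached to a part
`i₁ < ⋯ < i_k` is the ordered linear tree with leaves `i₁, …, i_k`: a strut if `k = 2`, and
otherwise a chain of `k - 2` trivalent vertices joined by `k - 3` internal edges. -/
@[ext]
structure RiordanTree (n : ℕ) where
  partition : Finpartition (Finset.univ : Finset (Fin n))
  two_le_card : ∀ B ∈ partition.parts, 2 ≤ B.card
  nonCrossing : ∀ A ∈ partition.parts, ∀ B ∈ partition.parts, A ≠ B →
    ∀ a ∈ A, ∀ b ∈ B, ∀ c ∈ A, ∀ d ∈ B, ¬ (a < b ∧ b < c ∧ c < d)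

/-- The position, among the `2n` strands at the `n` boxes, of the `j`-th strand at the boxes
that belong to `B` (box `i` carries the strands `2i` and `2i+1`). -/
def strandOf {n : ℕ} (B : Finset (Fin n)) (j : Fin (2 * B.card)) : Fin (2 * n) :=
  ⟨2 * (B.orderEmbOfFin rfl ⟨j.1 / 2, by omega⟩ : Fin n).1 + j.1 % 2, by
    have := (B.orderEmbOfFin rfl ⟨j.1 / 2, by omega⟩ : Fin n).2
    omega⟩

/-- The element of `V₁^{⊗2n}` represented by the disjoint union, over the parts `B` of the
partition, of the diagrams `D |B|` placed on the strands at the boxes in `B`. Placing a diagram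
between strands of another one is an insertion `1^{⊗a} ⊗ D ⊗ 1^{⊗b}`, so the coefficient of a
basis tensor in a disjoint union is the product of the coefficients for the components. -/
def placeOn (D : (k : ℕ) → V1Pow (2 * k)) {n : ℕ} (T : RiordanTree n) : V1Pow (2 * n) :=
  ∑ s : Fin (2 * n) → Fin 2,
    (∏ B ∈ T.partition.parts, (V1basis (2 * B.card)).repr (D B.card) (fun j => s (strandOf B j))) •
      V1basis (2 * n) s

/-- `π₂ (v^a ⊗ v^b)`, where `π₂ : V₁ ⊗ V₁ → V₂` is given by `v¹⊗v¹ ↦ v²`, `v¹⊗v⁻¹ ↦ q⁻¹ v⁰`,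
`v⁻¹⊗v¹ ↦ v⁰`, `v⁻¹⊗v⁻¹ ↦ v⁻²`, with `v² = v₂`, `v⁰ = [2]⁻¹ v₀`, `v⁻² = v₋₂`. -/
def boxVec : Fin 2 → Fin 2 → V2
  | 0, 0 => Pi.single 0 1
  | 0, 1 => Pi.single 1 (q⁻¹ * qTwo⁻¹)
  | 1, 0 => Pi.single 1 qTwo⁻¹
  | 1, 1 => Pi.single 2 1

/-- The map `π₂^{⊗n} : V₁^{⊗2n} → V₂^{⊗n}`. -/
def boxes (n : ℕ) : V1Pow (2 * n) →ₗ[Cq] V2Pow n :=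
  (V1basis (2 * n)).constr Cq fun s =>
    PiTensorProduct.tprod Cq fun j : Fin n =>
      boxVec (s ⟨2 * j.1, by omega⟩) (s ⟨2 * j.1 + 1, by omega⟩)

/-- `f⁰(T)`. -/
def f₀ {n : ℕ} (T : RiordanTree n) : V2Pow n := boxes n (placeOn linTree₀ T)

/-- `f(T)`. -/
def f {n : ℕ} (T : RiordanTree n) : V2Pow n := boxes n (placeOn linTree T)

/-- The dual canonical basis of the invariants of `V₁^{⊗2m}`: the elements
`(δ₁)^{2(m-1)}_{i_{m-1}} ⋯ (δ₁)^2_{i_1} (δ₁) 1` with `0 ≤ i_j ≤ j`. -/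
def dualCanonicalV1 : (m : ℕ) → Set (V1Pow (2 * m))
  | 0 => {emptyDiagram}
  | m + 1 => {y | ∃ x ∈ dualCanonicalV1 m, ∃ (i : ℕ) (hi : i ≤ m),
      y = cup (2 * m) ⟨i, by omega⟩ x}

/-- The Frenkel–Khovanov dual canonical basis of `Inv_{U_q}(V₂^{⊗n})`: the nonzero images under
`π₂^{⊗n}` of the dual canonical basis elements of the invariants of `V₁^{⊗2n}`. -/
def dualCanonical (n : ℕ) : Set (V2Pow n) :=
  {y | y ≠ 0 ∧ ∃ x ∈ dualCanonicalV1 n, y = boxes n x}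

end

end QuantumTree

namespace QuantumTree

noncomputable section

/-! A diagram is encoded by a noncrossing equivalence relation `r` on the boxes, with coefficients
`diag r` in the standard basis of `V₁^{⊗2n}`. An arc inserted at an even place creates a box joined
to itself (`insertPoint`); an arc at an odd place splits a box into two boxes of the same class
(`doublePoint`). These two moves produce all noncrossing partitions (`NonCrossing.induction`), so
the dual canonical elements upstairs are exactly their diagrams. Since `π₂ ∘ δ₁ = 0`, a singleton
class kills the image in `V₂^{⊗n}` (`boxes_eq_zero`), and what is left is indexed by Riordan trees.

Independence of the `f₀ T` comes from leading terms. Read `v¹` and `v⁻¹` as up and down steps and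
compare words by their heights. In a word of `diag r` each arc is up-down or down-up, so the word
with all arcs up-down is the highest (`height_le_of_diag_ne_zero`); it has coefficient 1 and
determines `r`. The map `π₂` identifies only up-down with down-up at a box. Without singletons the
leading word never has up-down at a box, hence it is the lowest word over its image
(`height_le_of_wordOf`). Squeezed between these bounds, the coefficient of `f₀ T` at `wordOf T.lead`
is a single nonzero term, and the matrix of leading coefficients is triangular.

For spanning, an invariant is a highest weight vector of weight 0 (`mem_Inv_iff`). Stripping tensor
factors from the right shows that it is determined by its coefficients at Riordan paths
(`eq_zero_of_coeff₂`), and every such path is the image of the leading word of a tree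
(`exists_riordanTree_of_path`). So the functionals that prove independence also bound the dimension,
and trees never have to be counted. The `f₀ T` are invariant because `E` kills arcs and commutes
with `π₂`, while arcs have weight 0.

For `f T`, a projector next to an arc gives that arc plus `[2]⁻¹` times the arc shifted by one place
(`jwAt_cup`). By induction a linear tree with projectors is the one-class diagram plus diagrams of
other noncrossing partitions of its leaves; multiplying over the parts and applying `π₂` leaves `f₀
T` plus terms from strictly finer trees (`exists_f_eq`). Any linear extension of refinement is then
a suitable order.

Words are functions on all of `ℕ`, so that deleting and adding letters requires no change of index
type. -/

/-! ### Coefficients with respect to the standard basis of `V₁^{⊗m}` -/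

/-- The coefficient of `x ∈ V₁^{⊗m}` at the first `m` letters of the word `s`. -/
def coeff₁ (m : ℕ) (s : ℕ → Fin 2) : V1Pow m →ₗ[Cq] Cq := (V1basis m).coord fun i => s i

/-- The coefficients of `δ₁(1)`. -/
def eps : Fin 2 → Fin 2 → Cq
  | 0, 1 => 1
  | 1, 0 => -q⁻¹
  | _, _ => 0

/-- The increasing map `ℕ → ℕ` that avoids `l` and `l + 1`. -/
def skip (l t : ℕ) : ℕ := if t < l then t else t + 2

/-- Extension of a finite word by zeros. -/
def extend {m : ℕ} {N : ℕ} [NeZero N] (t : Fin m → Fin N) (i : ℕ) : Fin N :=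
  if h : i < m then t ⟨i, h⟩ else 0

@[simp] theorem extend_apply {m N : ℕ} [NeZero N] (t : Fin m → Fin N) (i : Fin m) :
    extend t i = t i := by
  simp [extend]

theorem coeff₁_basis (m : ℕ) (s : ℕ → Fin 2) (t : Fin m → Fin 2) :
    coeff₁ m s (V1basis m t) = if t = fun i : Fin m => s i then 1 else 0 := by
  simp [coeff₁, Finsupp.single_apply]

theorem coeff₁_congr {m : ℕ} {s t : ℕ → Fin 2} (h : ∀ i < m, s i = t i) :
    coeff₁ m s = coeff₁ m t := by
  unfold coeff₁
  congr 1
  funext i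
  exact h i i.2

theorem ext_coeff₁ {m : ℕ} {x y : V1Pow m} (h : ∀ s, coeff₁ m s x = coeff₁ m s y) : x = y := by
  refine (V1basis m).ext_elem fun t => ?_
  simpa [coeff₁] using h (extend t)

theorem insertNth_insertNth_eq_iff {k : ℕ} (l : Fin (k + 1)) (a b : Fin 2) (t : Fin k → Fin 2)
    (s : ℕ → Fin 2) :
    (Fin.insertNth l.castSucc a (Fin.insertNth l b t : Fin (k + 1) → Fin 2) :
      Fin (k + 2) → Fin 2) = (fun i : Fin (k + 2) => s i) ↔
      a = s l ∧ b = s (l + 1) ∧ t = fun i : Fin k => s (skip l i) := by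
  rw [Fin.insertNth_eq_iff, Fin.insertNth_eq_iff]
  have h1 : ∀ i : Fin k, ((l.castSucc.succAbove (l.succAbove i) : Fin (k + 2)) : ℕ) = skip l i := by
    intro i
    simp only [Fin.succAbove, skip, Fin.lt_def]
    split_ifs <;> (simp_all; try omega)
  refine and_congr (by simp) (and_congr (by simp [Fin.removeNth]) ?_)
  simp only [funext_iff, Fin.removeNth, h1]

/-- On coefficients an arc becomes a scalar factor times the value at a word with two letters
deleted. All diagram computations use this form. -/
theorem coeff₁_cup (k : ℕ) (l : Fin (k + 1)) (s : ℕ → Fin 2) (x : V1Pow k) :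
    coeff₁ (k + 2) s (cup k l x) = eps (s l) (s (l + 1)) * coeff₁ k (s ∘ skip l) x := by
  suffices h : (coeff₁ (k + 2) s).comp (cup k l) =
      eps (s l) (s (l + 1)) • coeff₁ k (s ∘ skip l) from LinearMap.congr_fun h x
  refine (V1basis k).ext fun t => ?_
  simp only [LinearMap.comp_apply, cup, Module.Basis.constr_basis, map_sub, map_smul,
    coeff₁_basis, insertNth_insertNth_eq_iff, LinearMap.smul_apply, smul_eq_mul, Function.comp_def]
  generalize s l = a
  generalize s (l + 1) = b
  by_cases ht : t = fun i : Fin k => s (skip l i)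
  · fin_cases a <;> fin_cases b <;> simp [ht, eps]
  · simp [ht]

theorem skip_skip {i j : ℕ} (h : i ≤ j) : skip i ∘ skip j = skip (j + 2) ∘ skip i := by
  funext t
  simp only [skip, Function.comp]
  split_ifs <;> omega

theorem cup_cup {k i j : ℕ} (hij : i ≤ j) (hj : j < k + 1) (x : V1Pow k) :
    cup (k + 2) ⟨i, by omega⟩ (cup k ⟨j, hj⟩ x) =
      cup (k + 2) ⟨j + 2, by omega⟩ (cup k ⟨i, by omega⟩ x) := by
  refine ext_coeff₁ fun s => ?_
  have h1 : skip i j = j + 2 := by simp [skip]; omega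
  have h2 : skip i (j + 1) = j + 3 := by simp [skip]; omega
  have h3 : skip (j + 2) i = i := by simp [skip]; omega
  have h4 : skip (j + 2) (i + 1) = i + 1 := by simp [skip]; omega
  simp only [coeff₁_cup, Function.comp_apply, Function.comp_assoc, skip_skip hij, h1, h2, h3, h4]
  ring

/-- The definition only admits places up to the middle. An arc further to the right commutes past
the previous one by `cup_cup`, which leaves the previous one as the last to be inserted, at an
admissible place. -/
theorem dualCanonicalV1_cup {m : ℕ} {x : V1Pow (2 * m)} (hx : x ∈ dualCanonicalV1 m) {i : ℕ}
    (hi : i < 2 * m + 1) : cup (2 * m) ⟨i, hi⟩ x ∈ dualCanonicalV1 (m + 1) := by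
  induction m generalizing i with
  | zero => exact ⟨x, hx, i, by omega, rfl⟩
  | succ m ih =>
    by_cases him : i ≤ m + 1
    · exact ⟨x, hx, i, him, rfl⟩
    · obtain ⟨y, hy, j, hj, rfl⟩ := hx
      obtain ⟨i, rfl⟩ : ∃ i', i = i' + 2 := ⟨i - 2, by omega⟩
      refine ⟨cup (2 * m) ⟨i, by omega⟩ y, ih hy (by omega), j, by omega, ?_⟩
      exact (cup_cup (k := 2 * m) (i := j) (j := i) (by omega) (by omega) y).symm

/-! ### The Jones–Wenzl projector on an arc -/

theorem coeff₁_jwAt {m : ℕ} {i j : Fin m} (hij : i ≠ j) (s : ℕ → Fin 2) (x : V1Pow m) :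
    coeff₁ m s (jwAt i j x) = ∑ a : Fin 2, ∑ b : Fin 2, jw a b (s i) (s j) *
      coeff₁ m (Function.update (Function.update s i a) j b) x := by
  suffices h : (coeff₁ m s).comp (jwAt i j) = ∑ a : Fin 2, ∑ b : Fin 2, jw a b (s i) (s j) •
      coeff₁ m (Function.update (Function.update s i a) j b) by
    simpa using LinearMap.congr_fun h x
  refine (V1basis m).ext fun t => ?_
  have h1 : ∀ c d, (Function.update (Function.update t i c) j d = fun k : Fin m => s k) ↔
      (c = s i ∧ d = s j ∧ ∀ k, k ≠ i → k ≠ j → t k = s k) := by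
    intro c d
    constructor
    · intro h
      refine ⟨by simpa [Function.update_apply, hij] using congrFun h i,
        by simpa using congrFun h j, fun k hi hj => ?_⟩
      simpa [Function.update_apply, hi, hj] using congrFun h k
    · rintro ⟨rfl, rfl, h⟩
      funext k
      by_cases hj : k = j
      · simp [hj]
      · by_cases hi : k = i
        · simp [hi, hij]
        · simp [hi, hj, h k hi hj]
  have h2 : ∀ a b, (t = fun k : Fin m =>
      Function.update (Function.update s i a) j b (k : ℕ)) ↔
      (a = t i ∧ b = t j ∧ ∀ k, k ≠ i → k ≠ j → t k = s k) := by
    intro a b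
    constructor
    · intro h
      refine ⟨?_, ?_, fun k hi hj => ?_⟩
      · have := congrFun h i
        rw [Function.update_of_ne (by simpa [Fin.val_inj] using hij)] at this
        simpa using this.symm
      · simpa using (congrFun h j).symm
      · have := congrFun h k
        rwa [Function.update_of_ne (by simpa [Fin.val_inj] using hj),
          Function.update_of_ne (by simpa [Fin.val_inj] using hi)] at this
    · rintro ⟨rfl, rfl, h⟩
      funext k
      by_cases hj : k = j
      · simp [hj]
      · rw [Function.update_of_ne (by simpa [Fin.val_inj] using hj)]
        by_cases hi : k = i
        · simp [hi]
        · rw [Function.update_of_ne (by simpa [Fin.val_inj] using hi), h k hi hj]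
  simp only [LinearMap.comp_apply, jwAt, Module.Basis.constr_basis, map_sum, map_smul,
    LinearMap.sum_apply, LinearMap.smul_apply, coeff₁_basis, h1, h2]
  by_cases H : ∀ k, k ≠ i → k ≠ j → t k = s k
  · simp [ite_and, Finset.sum_ite_irrel]
  · simp [H]

theorem qTwo_eq : qTwo = q + q⁻¹ := by
  have h := q_sub_inv_ne_zero
  rw [qTwo, div_eq_iff h]
  have hq := q_ne_zero
  field_simp
  ring

theorem qTwo_ne_zero : qTwo ≠ 0 := by
  rw [qTwo_eq]
  intro h
  have hq := q_ne_zero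
  have h1 : q ^ 2 + 1 = 0 := by
    field_simp at h
    simpa using h
  have h1 : algebraMap (Polynomial ℂ) (RatFunc ℂ) (Polynomial.X ^ 2 + 1) =
      algebraMap (Polynomial ℂ) (RatFunc ℂ) 0 := by
    simpa [q, RatFunc.algebraMap_X] using h1
  have h2 := RatFunc.algebraMap_injective ℂ h1
  have h3 := congrArg (Polynomial.eval 0) h2
  simp at h3

/-- This is `p₂ = 1 + [2]⁻¹ (cup ∘ cap)` with the cap already straightened against an arc: `e` is
the free end of that arc, and `X` is the dependence on the second strand entering the projector. -/
theorem jw_eps (c d e : Fin 2) (X : Fin 2 → Cq) :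
    ∑ a : Fin 2, ∑ b : Fin 2, jw a b c d * (eps e a * X b) =
      eps e c * X d + qTwo⁻¹ * (eps c d * X e) := by
  have hq := q_ne_zero
  have h2 := qTwo_ne_zero
  have h3 : q * qTwo = q ^ 2 + 1 := by rw [qTwo_eq]; field_simp
  fin_cases c <;> fin_cases d <;> fin_cases e <;> simp [jw, eps] <;> field_simp <;>
    first | ring1 | linear_combination X 1 * h3 | linear_combination -X 0 * h3

theorem jwAt_cup {k l : ℕ} (hl : l + 1 < k + 1) (x : V1Pow k) :
    jwAt (⟨l + 1, by omega⟩ : Fin (k + 2)) ⟨l + 2, by omega⟩ (cup k ⟨l, by omega⟩ x) =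
      cup k ⟨l, by omega⟩ x + qTwo⁻¹ • cup k ⟨l + 1, hl⟩ x := by
  refine ext_coeff₁ fun s => ?_
  rw [coeff₁_jwAt (by simp [Fin.ext_iff])]
  simp only [map_add, map_smul, coeff₁_cup, smul_eq_mul]
  -- Once the arc at `l` is removed, strand `l + 2` sits at place `l`; this is the letter on which
  -- `X` depends.
  have h := jw_eps (s (l + 1)) (s (l + 2)) (s l)
    (fun b => coeff₁ k (Function.update (s ∘ skip l) l b) x)
  convert h using 2
  · refine Finset.sum_congr rfl fun b _ => ?_
    congr 2
    · simp
    · refine LinearMap.congr_fun (coeff₁_congr fun i hi => ?_) x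
      simp only [Function.comp_apply, Function.update_apply, skip]
      split_ifs <;> first | rfl | omega
  · congr 1
    refine LinearMap.congr_fun (coeff₁_congr fun i hi => ?_) x
    simp only [Function.comp_apply, Function.update_apply, skip]
    split_ifs <;> first | rfl | omega | (congr 1 <;> omega)
  · congr 2
    refine LinearMap.congr_fun (coeff₁_congr fun i hi => ?_) x
    simp only [Function.comp_apply, Function.update_apply, skip]
    split_ifs <;> first | rfl | omega | congr 1

/-! ### Heights of words -/

/-- The height of a word after `k` letters, the letters `0` and `1` being an up and a down step. -/
def height (s : ℕ → Fin 2) (k : ℕ) : ℤ := ∑ i ∈ Finset.range k, if s i = 0 then 1 else -1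

@[simp] theorem height_zero (s : ℕ → Fin 2) : height s 0 = 0 := rfl

theorem height_succ (s : ℕ → Fin 2) (k : ℕ) :
    height s (k + 1) = height s k + if s k = 0 then 1 else -1 :=
  Finset.sum_range_succ _ _

theorem fin_two_ne_zero {a : Fin 2} : a ≠ 0 ↔ a = 1 := by
  fin_cases a <;> simp

theorem eps_ne_zero {a b : Fin 2} (h : eps a b ≠ 0) : a ≠ b := by
  rintro rfl
  fin_cases a <;> simp [eps] at h

theorem height_skip_of_le (s : ℕ → Fin 2) {l k : ℕ} (h : k ≤ l) :
    height (s ∘ skip l) k = height s k := by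
  refine Finset.sum_congr rfl fun i hi => ?_
  have : i < l := by have := Finset.mem_range.1 hi; omega
  simp [skip, this]

theorem height_skip_of_ge {s : ℕ → Fin 2} {l k : ℕ} (hs : s l ≠ s (l + 1)) (h : l ≤ k) :
    height (s ∘ skip l) k = height s (k + 2) := by
  induction k, h using Nat.le_induction with
  | base =>
    rw [height_skip_of_le s le_rfl, height_succ, height_succ]
    generalize s l = a at *
    generalize s (l + 1) = b at *
    fin_cases a <;> fin_cases b <;> simp at hs ⊢
  | succ k hk ih =>
    rw [height_succ, ih, height_succ s (k + 2)]
    have : ¬ k < l := by omega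
    simp [skip, this]

/-- Deleting a balanced pair does not change the heights outside it, and between the two letters
up-down is at least as high as down-up. -/
theorem height_le_of_skip {s u : ℕ → Fin 2} {l N : ℕ} (hl : l ≤ N) (hs : s l ≠ s (l + 1))
    (hu : u l = 0) (hu' : u (l + 1) = 1)
    (h : ∀ k ≤ N, height (s ∘ skip l) k ≤ height (u ∘ skip l) k) :
    ∀ k ≤ N + 2, height s k ≤ height u k := by
  intro k hk
  have hne : u l ≠ u (l + 1) := by simp [hu, hu']
  rcases lt_or_ge k (l + 2) with h1 | h1
  · have h2 := h l hl
    rw [height_skip_of_le _ le_rfl, height_skip_of_le _ le_rfl] at h2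
    rcases lt_or_ge k (l + 1) with h3 | h3
    · have := h k (by omega)
      rwa [height_skip_of_le _ (by omega), height_skip_of_le _ (by omega)] at this
    · obtain rfl : k = l + 1 := by omega
      rw [height_succ, height_succ, hu]
      split_ifs <;> simp_all
      omega
  · obtain ⟨k, rfl⟩ : ∃ k', k = k' + 2 := ⟨k - 2, by omega⟩
    have := h k (by omega)
    rwa [height_skip_of_ge hs (by omega), height_skip_of_ge hne (by omega)] at this

theorem eq_of_height_eq {s u : ℕ → Fin 2} {N : ℕ} (h : ∀ k ≤ N, height s k = height u k) :
    ∀ i < N, s i = u i := by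
  intro i hi
  have h1 := h i hi.le
  have h2 := h (i + 1) hi
  rw [height_succ, height_succ, h1] at h2
  by_cases hs : s i = 0 <;> by_cases hu : u i = 0 <;> simp [hs, hu] at h2 ⊢
  rw [fin_two_ne_zero.1 hs, fin_two_ne_zero.1 hu]

/-! ### Diagrams attached to partitions -/

/-- A partition of `Fin n`, given as an equivalence relation, is noncrossing. -/
def NonCrossing {n : ℕ} (r : Setoid (Fin n)) : Prop :=
  ∀ a b c d, a < b → b < c → c < d → r a c → r b d → r a b

/-- `k` is the element of the class of `i` that follows `i`. -/
def IsNext {n : ℕ} (r : Setoid (Fin n)) (i k : Fin n) : Prop :=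
  r i k ∧ i < k ∧ ∀ x, r i x → i < x → k ≤ x

/-- `k` is the first element of the class of `i`. -/
def IsFirst {n : ℕ} (r : Setoid (Fin n)) (i k : Fin n) : Prop :=
  r i k ∧ ∀ x, r i x → k ≤ x

theorem IsNext.unique {n : ℕ} {r : Setoid (Fin n)} {i k k' : Fin n} (h : IsNext r i k)
    (h' : IsNext r i k') : k = k' :=
  le_antisymm (h.2.2 _ h'.1 h'.2.1) (h'.2.2 _ h.1 h.2.1)

theorem IsFirst.unique {n : ℕ} {r : Setoid (Fin n)} {i k k' : Fin n} (h : IsFirst r i k)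
    (h' : IsFirst r i k') : k = k' :=
  le_antisymm (h.2 _ h'.1) (h'.2 _ h.1)

theorem exists_isNext {n : ℕ} {r : Setoid (Fin n)} {i k : Fin n} (h : r i k) (hk : i < k) :
    ∃ k, IsNext r i k := by
  classical
  have hne : (Finset.univ.filter fun x => r i x ∧ i < x).Nonempty := ⟨k, by simp [h, hk]⟩
  have h1 := Finset.min'_mem _ hne
  simp only [Finset.mem_filter, Finset.mem_univ, true_and] at h1
  exact ⟨_, h1.1, h1.2, fun x hx hix => Finset.min'_le _ _ (by simp [hx, hix])⟩

theorem exists_isFirst {n : ℕ} (r : Setoid (Fin n)) (i : Fin n) : ∃ k, IsFirst r i k := by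
  classical
  have hne : (Finset.univ.filter fun x => r i x).Nonempty := ⟨i, by simp⟩
  have h1 := Finset.min'_mem _ hne
  simp only [Finset.mem_filter, Finset.mem_univ, true_and] at h1
  exact ⟨_, h1, fun x hx => Finset.min'_le _ _ (by simp [hx])⟩

open Classical in
/-- The coefficient of the arc that starts at the right strand of the box `i`. -/
def arc {n : ℕ} (r : Setoid (Fin n)) (s : ℕ → Fin 2) (i : Fin n) : Cq :=
  if h : ∃ k, IsNext r i k then eps (s (2 * i + 1)) (s (2 * (h.choose : Fin n)))
  else eps (s (2 * ((exists_isFirst r i).choose : Fin n))) (s (2 * i + 1))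

/-- The coefficients of the boundary of an annular neighbourhood of the linear trees on the
classes of `r`. -/
def diag {n : ℕ} (r : Setoid (Fin n)) (s : ℕ → Fin 2) : Cq := ∏ i, arc r s i

theorem arc_of_isNext {n : ℕ} {r : Setoid (Fin n)} (s : ℕ → Fin 2) {i k : Fin n}
    (h : IsNext r i k) : arc r s i = eps (s (2 * i + 1)) (s (2 * k)) := by
  have h' : ∃ k, IsNext r i k := ⟨k, h⟩
  rw [arc, dif_pos h', h'.choose_spec.unique h]

theorem arc_of_isFirst {n : ℕ} {r : Setoid (Fin n)} (s : ℕ → Fin 2) {i k : Fin n}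
    (hi : ∀ x, r i x → x ≤ i) (h : IsFirst r i k) :
    arc r s i = eps (s (2 * k)) (s (2 * i + 1)) := by
  have h' : ¬ ∃ k, IsNext r i k := fun ⟨k, hk⟩ => absurd (hi k hk.1) (not_le.2 hk.2.1)
  rw [arc, dif_neg h', (exists_isFirst r i).choose_spec.unique h]

/-- Comparison of arcs of two partitions, where `lo k` is the first element of the class of `i'`
that corresponds to `k`. -/
theorem arc_transfer {n m : ℕ} {r : Setoid (Fin n)} {r' : Setoid (Fin m)} {s s' : ℕ → Fin 2}
    {i : Fin n} {i' : Fin m} (lo : Fin n → Fin m) (hlo : Monotone lo)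
    (h1 : ∀ k, r i k → r' i' (lo k))
    (h2 : ∀ x, r' i' x → ∃ k, r i k ∧ lo k ≤ x ∧ (i' < x → i < k))
    (h3 : ∀ k, r i k → i < k → i' < lo k)
    (hL : ∀ k, s' (2 * (lo k : ℕ)) = s (2 * (k : ℕ)))
    (hR : s' (2 * (i' : ℕ) + 1) = s (2 * (i : ℕ) + 1)) :
    arc r' s' i' = arc r s i := by
  by_cases h : ∃ k, IsNext r i k
  · obtain ⟨k, hk⟩ := h
    have hk' : IsNext r' i' (lo k) := by
      refine ⟨h1 k hk.1, h3 k hk.1 hk.2.1, fun x hx hix => ?_⟩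
      obtain ⟨y, hy, hyx, hiy⟩ := h2 x hx
      exact (hlo (hk.2.2 y hy (hiy hix))).trans hyx
    rw [arc_of_isNext s hk, arc_of_isNext s' hk', hL, hR]
  · have hi : ∀ x, r i x → x ≤ i := fun x hx => not_lt.1 fun hix => h (exists_isNext hx hix)
    obtain ⟨k, hk⟩ := exists_isFirst r i
    have hi' : ∀ x, r' i' x → x ≤ i' := by
      intro x hx
      obtain ⟨y, hy, hyx, hiy⟩ := h2 x hx
      exact not_lt.1 fun hix => absurd (hi y hy) (not_le.2 (hiy hix))
    have hk' : IsFirst r' i' (lo k) := by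
      refine ⟨h1 k hk.1, fun x hx => ?_⟩
      obtain ⟨y, hy, hyx, hiy⟩ := h2 x hx
      exact (hlo (hk.2 y hy)).trans hyx
    rw [arc_of_isFirst s hi hk, arc_of_isFirst s' hi' hk', hL, hR]

theorem diag_congr {n : ℕ} (r : Setoid (Fin n)) {s t : ℕ → Fin 2} (h : ∀ i < 2 * n, s i = t i) :
    diag r s = diag r t := by
  refine Finset.prod_congr rfl fun i _ => ?_
  refine arc_transfer id monotone_id (fun _ h => h) (fun x hx => ⟨x, hx, le_rfl, id⟩)
    (fun _ _ h => h) (fun k => h _ ?_) (h _ ?_)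
  · have := k.2
    simp only [id]
    omega
  · have := i.2
    omega

/-! ### Insertion of a singleton and doubling of a point -/

/-- Insertion of a new point `j` that forms a class of its own. -/
def insertPoint {m : ℕ} (j : Fin (m + 1)) (r : Setoid (Fin m)) : Setoid (Fin (m + 1)) where
  r a b := a = b ∨ ∃ x y, a = j.succAbove x ∧ b = j.succAbove y ∧ r x y
  iseqv := by
    refine ⟨fun a => Or.inl rfl, ?_, ?_⟩
    · rintro a b (rfl | ⟨x, y, rfl, rfl, h⟩)
      · exact Or.inl rfl
      · exact Or.inr ⟨y, x, rfl, rfl, r.symm' h⟩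
    · rintro a b c (rfl | ⟨x, y, rfl, rfl, h⟩) (rfl | ⟨x', y', h1, rfl, h'⟩)
      · exact Or.inl rfl
      · exact Or.inr ⟨x', y', h1, rfl, h'⟩
      · exact Or.inr ⟨x, y, rfl, rfl, h⟩
      · obtain rfl := Fin.succAbove_right_injective h1
        exact Or.inr ⟨x, y', rfl, rfl, r.trans' h h'⟩

/-- Replacement of the point `j` by two points of the same class. -/
def doublePoint {m : ℕ} (j : Fin m) (r : Setoid (Fin m)) : Setoid (Fin (m + 1)) :=
  r.comap j.predAbove

theorem insertPoint_succAbove {m : ℕ} (j : Fin (m + 1)) (r : Setoid (Fin m)) (x y : Fin m) :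
    insertPoint j r (j.succAbove x) (j.succAbove y) ↔ r x y := by
  constructor
  · rintro (h | ⟨x', y', h1, h2, h⟩)
    · rw [Fin.succAbove_right_injective h]
    · rwa [Fin.succAbove_right_injective h1, Fin.succAbove_right_injective h2]
  · exact fun h => Or.inr ⟨x, y, rfl, rfl, h⟩

theorem insertPoint_self {m : ℕ} (j : Fin (m + 1)) (r : Setoid (Fin m)) (k : Fin (m + 1)) :
    insertPoint j r j k ↔ k = j := by
  constructor
  · rintro (h | ⟨x, y, h1, h2, h⟩)
    · exact h.symm
    · exact absurd h1.symm (Fin.succAbove_ne _ _)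
  · exact fun h => Or.inl h.symm

theorem insertPoint_succAbove_self {m : ℕ} (j : Fin (m + 1)) (r : Setoid (Fin m)) (x : Fin m) :
    ¬ insertPoint j r (j.succAbove x) j := fun h =>
  Fin.succAbove_ne j x ((insertPoint_self j r _).1 ((insertPoint j r).symm' h))

theorem doublePoint_rel {m : ℕ} (j : Fin m) (r : Setoid (Fin m)) (a b : Fin (m + 1)) :
    doublePoint j r a b ↔ r (j.predAbove a) (j.predAbove b) := Iff.rfl

theorem val_predAbove {m : ℕ} (j : Fin m) (x : Fin (m + 1)) :
    (j.predAbove x : ℕ) = if (j : ℕ) < x then (x : ℕ) - 1 else x := by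
  simp only [Fin.predAbove, Fin.lt_def, Fin.val_castSucc]
  split_ifs <;> simp

theorem val_succAbove {m : ℕ} (j : Fin (m + 1)) (x : Fin m) :
    (j.succAbove x : ℕ) = if (x : ℕ) < j then (x : ℕ) else x + 1 := by
  simp only [Fin.succAbove, Fin.lt_def, Fin.val_castSucc]
  split_ifs <;> simp

theorem predAbove_succ_succAbove {m : ℕ} (j k : Fin m) :
    j.predAbove (j.succ.succAbove k) = k := by
  simp only [Fin.ext_iff, val_predAbove, val_succAbove, Fin.val_succ]
  split_ifs <;> omega

theorem predAbove_castSucc_succAbove {m : ℕ} (j k : Fin m) :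
    j.predAbove (j.castSucc.succAbove k) = k := by
  simp only [Fin.ext_iff, val_predAbove, val_succAbove, Fin.val_castSucc]
  split_ifs <;> omega

/-- The fibre of `predAbove` over `j` consists of the two copies of `j`. Omitting `j.succ` keeps the
lower copy, which gives the adjunction for `≤`; omitting `j.castSucc` keeps the upper copy, which
gives the strict version below. -/
theorem succ_succAbove_le_iff {m : ℕ} (j k : Fin m) (x : Fin (m + 1)) :
    j.succ.succAbove k ≤ x ↔ k ≤ j.predAbove x := by
  simp only [Fin.le_def, val_predAbove, val_succAbove, Fin.val_succ]
  split_ifs <;> omega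

theorem castSucc_succAbove_lt_iff {m : ℕ} (j k : Fin m) (x : Fin (m + 1)) :
    j.castSucc.succAbove k < x ↔ k < j.predAbove x := by
  simp only [Fin.lt_def, val_predAbove, val_succAbove, Fin.val_castSucc]
  split_ifs <;> omega

/-- The arc of a singleton joins the two strands of its own box; all other arcs are carried along by
an order embedding. Comparison with `coeff₁_cup` identifies this move with an arc at an even place.
-/
theorem diag_insertPoint {m : ℕ} (j : Fin (m + 1)) (r : Setoid (Fin m)) (s : ℕ → Fin 2) :
    diag (insertPoint j r) s =
      eps (s (2 * j)) (s (2 * j + 1)) * diag r (s ∘ skip (2 * j)) := by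
  rw [diag, Fin.prod_univ_succAbove _ j]
  congr 1
  · refine arc_of_isFirst s (fun x hx => ((insertPoint_self j r x).1 hx).le) ⟨Or.inl rfl, ?_⟩
    exact fun x hx => ((insertPoint_self j r x).1 hx).ge
  · refine Finset.prod_congr rfl fun i _ => ?_
    refine arc_transfer j.succAbove (Fin.strictMono_succAbove j).monotone
      (fun k hk => (insertPoint_succAbove j r i k).2 hk) (fun x hx => ?_)
      (fun k _ hik => Fin.strictMono_succAbove j hik) (fun k => ?_) ?_
    · obtain rfl | ⟨y, rfl⟩ := Fin.eq_self_or_eq_succAbove j x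
      · exact absurd hx (insertPoint_succAbove_self _ r i)
      · exact ⟨y, (insertPoint_succAbove j r i y).1 hx, le_rfl, fun h =>
          (Fin.strictMono_succAbove j).lt_iff_lt.1 h⟩
    · simp only [Function.comp_apply, skip, val_succAbove]
      congr 1
      split_ifs <;> omega
    · simp only [Function.comp_apply, skip, val_succAbove]
      congr 1
      split_ifs <;> omega

theorem diag_doublePoint {m : ℕ} (j : Fin m) (r : Setoid (Fin m)) (s : ℕ → Fin 2) :
    diag (doublePoint j r) s =
      eps (s (2 * j + 1)) (s (2 * j + 2)) * diag r (s ∘ skip (2 * j + 1)) := by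
  rw [diag, Fin.prod_univ_succAbove _ j.castSucc]
  congr 1
  · have h : IsNext (doublePoint j r) j.castSucc j.succ := by
      refine ⟨?_, Fin.castSucc_lt_succ, fun x _ hx => ?_⟩
      · simp [doublePoint_rel]
      · rw [Fin.le_def, Fin.val_succ]
        exact hx
    rw [arc_of_isNext s h]
    rfl
  · refine Finset.prod_congr rfl fun i _ => ?_
    -- When a box is split, its left strand stays with the lower copy and its right strand goes to
    -- the upper copy. Arcs are indexed by right strands, hence by upper copies, but the left
    -- strands they meet belong to lower copies.
    refine arc_transfer j.succ.succAbove (Fin.strictMono_succAbove _).monotone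
      (fun k hk => ?_) (fun x hx => ⟨j.predAbove x, ?_, ?_, ?_⟩) (fun k _ hik => ?_)
      (fun k => ?_) ?_
    · rwa [doublePoint_rel, predAbove_castSucc_succAbove, predAbove_succ_succAbove]
    · rwa [doublePoint_rel, predAbove_castSucc_succAbove] at hx
    · exact (succ_succAbove_le_iff _ _ _).2 le_rfl
    · exact (castSucc_succAbove_lt_iff _ _ _).1
    · rwa [castSucc_succAbove_lt_iff, predAbove_succ_succAbove]
    · simp only [Function.comp_apply, skip, val_succAbove, Fin.val_succ]
      congr 1
      split_ifs <;> omega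
    · simp only [Function.comp_apply, skip, val_succAbove, Fin.val_castSucc]
      congr 1
      split_ifs <;> omega

theorem NonCrossing.insertPoint {m : ℕ} {r : Setoid (Fin m)} (hr : NonCrossing r)
    (j : Fin (m + 1)) : NonCrossing (insertPoint j r) := by
  rintro a b c d hab hbc hcd (rfl | ⟨x, y, rfl, rfl, h⟩) (rfl | ⟨x', y', rfl, rfl, h'⟩)
  · exact absurd (hab.trans hbc) (lt_irrefl _)
  · exact absurd (hab.trans hbc) (lt_irrefl _)
  · exact absurd (hbc.trans hcd) (lt_irrefl _)
  · have hj := Fin.strictMono_succAbove j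
    exact (insertPoint_succAbove j r x x').2
      (hr x x' y y' (hj.lt_iff_lt.1 hab) (hj.lt_iff_lt.1 hbc) (hj.lt_iff_lt.1 hcd) h h')

theorem NonCrossing.doublePoint {m : ℕ} {r : Setoid (Fin m)} (hr : NonCrossing r)
    (j : Fin m) : NonCrossing (doublePoint j r) := by
  intro a b c d hab hbc hcd h h'
  rw [doublePoint_rel] at *
  have hj := Fin.predAbove_right_monotone j
  rcases (hj hab.le).lt_or_eq with h1 | h1
  · rcases (hj hbc.le).lt_or_eq with h2 | h2
    · rcases (hj hcd.le).lt_or_eq with h3 | h3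
      · exact hr _ _ _ _ h1 h2 h3 h h'
      · rw [h3] at h
        exact r.trans' h (r.symm' h')
    · rwa [h2]
  · rw [h1]

theorem NonCrossing.comap {m n : ℕ} {r : Setoid (Fin n)} (hr : NonCrossing r)
    {e : Fin m → Fin n} (he : StrictMono e) : NonCrossing (r.comap e) :=
  fun _ _ _ _ hab hbc hcd h h' => hr _ _ _ _ (he hab) (he hbc) (he hcd) h h'

theorem insertPoint_comap {m : ℕ} {r : Setoid (Fin (m + 1))} {j : Fin (m + 1)}
    (hj : ∀ k, r j k → k = j) : insertPoint j (r.comap j.succAbove) = r := by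
  ext a b
  obtain rfl | ⟨x, rfl⟩ := Fin.eq_self_or_eq_succAbove j a
  · exact (insertPoint_self _ _ _).trans
      ⟨fun h => h ▸ r.refl' _, fun h => hj _ h⟩
  · obtain rfl | ⟨y, rfl⟩ := Fin.eq_self_or_eq_succAbove j b
    · exact iff_of_false (insertPoint_succAbove_self _ _ _)
        fun h => Fin.succAbove_ne _ _ (hj _ (r.symm' h))
    · exact insertPoint_succAbove _ _ _ _

theorem doublePoint_comap {m : ℕ} {r : Setoid (Fin (m + 1))} {j : Fin m}
    (hj : r j.castSucc j.succ) : doublePoint j (r.comap j.succ.succAbove) = r := by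
  have h : ∀ x, r x (j.succ.succAbove (j.predAbove x)) := by
    intro x
    obtain rfl | ⟨y, rfl⟩ := Fin.eq_self_or_eq_succAbove j.succ x
    · simpa using r.symm' hj
    · rw [predAbove_succ_succAbove]
  ext a b
  exact ⟨fun hab => r.trans' (h a) (r.trans' hab (r.symm' (h b))),
    fun hab => r.trans' (r.symm' (h a)) (r.trans' hab (h b))⟩

/-- Consider the right neighbour of `a`. If it is neither related to `a` nor alone, noncrossing
traps its partner between it and `b`, so there is a related pair at smaller distance. -/
theorem NonCrossing.exists_of_rel {m : ℕ} {r : Setoid (Fin (m + 1))} (hr : NonCrossing r)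
    {a b : Fin (m + 1)} (hab : a < b) (h : r a b) :
    (∃ j, ∀ k, r j k → k = j) ∨ ∃ j : Fin m, r j.castSucc j.succ := by
  obtain ⟨d, hd⟩ : ∃ d, (b : ℕ) = a + d := ⟨b - a, by have := Fin.lt_def.1 hab; omega⟩
  induction d using Nat.strong_induction_on generalizing a b with
  | _ d ih =>
    have hab' := Fin.lt_def.1 hab
    have hb := b.2
    let j : Fin m := ⟨a, by omega⟩
    have hja : j.castSucc = a := rfl
    have hac : a < j.succ := hja ▸ Fin.castSucc_lt_succ
    by_cases hjac : r a j.succ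
    · exact Or.inr ⟨j, hjac⟩
    by_cases hs : ∀ k, r j.succ k → k = j.succ
    · exact Or.inl ⟨_, hs⟩
    push Not at hs
    obtain ⟨e, he, hne⟩ := hs
    have hcb : j.succ < b := by
      refine lt_of_le_of_ne ?_ fun hcb => hjac (hcb ▸ h)
      rw [Fin.le_def, Fin.val_succ]
      exact hab'
    have hd' : ((j.succ : Fin (m + 1)) : ℕ) = a + 1 := rfl
    rcases lt_or_gt_of_ne hne with h1 | h1
    · rcases lt_trichotomy e a with h2 | h2 | h2
      · exact absurd (r.trans' (r.symm' (hr e a j.succ b h2 hac hcb (r.symm' he) h)) (r.symm' he))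
          hjac
      · exact absurd (h2 ▸ r.symm' he) hjac
      · rw [Fin.lt_def] at h1 h2
        omega
    · rcases le_or_gt e b with h2 | h2
      · rw [Fin.le_def] at h2
        rw [Fin.lt_def] at h1
        exact ih (e - j.succ) (by omega) h1 he (by omega)
      · exact absurd (hr a j.succ b e hac hcb h2 h he) hjac

theorem NonCrossing.exists_singleton_or_adjacent {m : ℕ} {r : Setoid (Fin (m + 1))}
    (hr : NonCrossing r) : (∃ j, ∀ k, r j k → k = j) ∨ ∃ j : Fin m, r j.castSucc j.succ := by
  by_cases h : ∀ k, r 0 k → k = 0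
  · exact Or.inl ⟨0, h⟩
  · push Not at h
    obtain ⟨k, hk, hk0⟩ := h
    exact hr.exists_of_rel (Fin.pos_iff_ne_zero.2 hk0) hk

/-- Every noncrossing partition arises from the empty one by inserting singletons and doubling
points. -/
theorem NonCrossing.induction {motive : ∀ n (r : Setoid (Fin n)), NonCrossing r → Prop}
    (zero : ∀ r hr, motive 0 r hr)
    (insert : ∀ m (j : Fin (m + 1)) r (hr : NonCrossing r), motive m r hr →
      motive (m + 1) (QuantumTree.insertPoint j r) (hr.insertPoint j))
    (double : ∀ m (j : Fin m) r (hr : NonCrossing r), motive m r hr →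
      motive (m + 1) (QuantumTree.doublePoint j r) (hr.doublePoint j))
    {n : ℕ} {r : Setoid (Fin n)} (hr : NonCrossing r) : motive n r hr := by
  induction n with
  | zero => exact zero r hr
  | succ m ih =>
    rcases hr.exists_singleton_or_adjacent with ⟨j, hj⟩ | ⟨j, hj⟩
    · have h := hr.comap (Fin.strictMono_succAbove j)
      have := insert m j _ h (ih h)
      simpa only [insertPoint_comap hj] using this
    · have h := hr.comap (Fin.strictMono_succAbove j.succ)
      have := double m j _ h (ih h)
      simpa only [doublePoint_comap hj] using this

/-! ### Leading words -/

/-- The word `s` starts with the orientation of the strands in which every arc of the diagram of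
`r` goes up at its left end and down at its right end. -/
def IsLead {n : ℕ} (r : Setoid (Fin n)) (s : ℕ → Fin 2) : Prop :=
  ∀ i : Fin n, (s (2 * i) = 0 ↔ ∀ k, r i k → i ≤ k) ∧ (s (2 * i + 1) = 0 ↔ ∃ k, r i k ∧ i < k)

/-- Leading words obey the same recursion as diagrams, the new arc being read as an up step and then
a down step. This keeps them compatible with `NonCrossing.induction`. -/
theorem isLead_insertPoint {m : ℕ} (j : Fin (m + 1)) (r : Setoid (Fin m)) (s : ℕ → Fin 2) :
    IsLead (insertPoint j r) s ↔
      s (2 * j) = 0 ∧ s (2 * j + 1) = 1 ∧ IsLead r (s ∘ skip (2 * j)) := by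
  have hj := Fin.strictMono_succAbove j
  rw [IsLead, Fin.forall_iff_succAbove j, ← and_assoc]
  refine and_congr (and_congr ?_ ?_) (forall_congr' fun i => and_congr ?_ ?_)
  · simp only [insertPoint_self]
    simp
  · simp only [insertPoint_self, ← fin_two_ne_zero]
    simp
  · have h : skip (2 * j) (2 * i) = 2 * (j.succAbove i : ℕ) := by
      simp only [skip, val_succAbove]
      split_ifs <;> omega
    rw [Function.comp_apply, h, Fin.forall_iff_succAbove j]
    simp only [insertPoint_succAbove, insertPoint_succAbove_self, hj.le_iff_le, false_imp_iff,
      true_and]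
  · have h : skip (2 * j) (2 * i + 1) = 2 * (j.succAbove i : ℕ) + 1 := by
      simp only [skip, val_succAbove]
      split_ifs <;> omega
    rw [Function.comp_apply, h, Fin.exists_iff_succAbove j]
    simp only [insertPoint_succAbove, insertPoint_succAbove_self, hj.lt_iff_lt, false_and,
      false_or]

theorem predAbove_surjective {m : ℕ} (j : Fin m) : Function.Surjective j.predAbove :=
  fun k => ⟨_, predAbove_succ_succAbove j k⟩

theorem isLead_doublePoint {m : ℕ} (j : Fin m) (r : Setoid (Fin m)) (s : ℕ → Fin 2) :
    IsLead (doublePoint j r) s ↔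
      s (2 * j + 1) = 0 ∧ s (2 * j + 2) = 1 ∧ IsLead r (s ∘ skip (2 * j + 1)) := by
  simp only [IsLead, forall_and]
  -- Left letters are reindexed by lower copies and right letters by upper copies; the remaining
  -- letter of each kind is an end of the new arc.
  rw [Fin.forall_iff_succAbove j.succ, Fin.forall_iff_succAbove (P := fun i : Fin (m + 1) =>
    (s (2 * i + 1) = 0 ↔ ∃ k, doublePoint j r i k ∧ i < k)) j.castSucc]
  have h1 : (s (2 * (j.succ : Fin (m + 1)) ) = 0 ↔
      ∀ k, doublePoint j r j.succ k → j.succ ≤ k) ↔ s (2 * j + 2) = 1 := by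
    have : ¬ ∀ k, doublePoint j r j.succ k → j.succ ≤ k := by
      intro h
      have := h j.castSucc (by simp [doublePoint_rel])
      exact absurd this (not_le.2 Fin.castSucc_lt_succ)
    rw [← fin_two_ne_zero, iff_false_right this]
    rfl
  have h2 : (s (2 * (j.castSucc : Fin (m + 1)) + 1) = 0 ↔
      ∃ k, doublePoint j r j.castSucc k ∧ j.castSucc < k) ↔ s (2 * j + 1) = 0 := by
    have : ∃ k, doublePoint j r j.castSucc k ∧ j.castSucc < k :=
      ⟨j.succ, by simp [doublePoint_rel], Fin.castSucc_lt_succ⟩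
    rw [iff_true_right this]
    rfl
  have h3 : ∀ i : Fin m, (s (2 * (j.succ.succAbove i : ℕ)) = 0 ↔
      ∀ k, doublePoint j r (j.succ.succAbove i) k → j.succ.succAbove i ≤ k) ↔
      ((s ∘ skip (2 * j + 1)) (2 * i) = 0 ↔ ∀ k, r i k → i ≤ k) := by
    intro i
    have h : skip (2 * j + 1) (2 * i) = 2 * (j.succ.succAbove i : ℕ) := by
      simp only [skip, val_succAbove, Fin.val_succ]
      split_ifs <;> omega
    rw [Function.comp_apply, h, (predAbove_surjective j).forall]
    simp only [doublePoint_rel, predAbove_succ_succAbove, succ_succAbove_le_iff]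
  have h4 : ∀ i : Fin m, (s (2 * (j.castSucc.succAbove i : ℕ) + 1) = 0 ↔
      ∃ k, doublePoint j r (j.castSucc.succAbove i) k ∧ j.castSucc.succAbove i < k) ↔
      ((s ∘ skip (2 * j + 1)) (2 * i + 1) = 0 ↔ ∃ k, r i k ∧ i < k) := by
    intro i
    have h : skip (2 * j + 1) (2 * i + 1) = 2 * (j.castSucc.succAbove i : ℕ) + 1 := by
      simp only [skip, val_succAbove, Fin.val_castSucc]
      split_ifs <;> omega
    rw [Function.comp_apply, h, (predAbove_surjective j).exists]
    simp only [doublePoint_rel, predAbove_castSucc_succAbove, castSucc_succAbove_lt_iff]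
  rw [h1, h2, forall_congr' h3, forall_congr' h4]
  tauto

theorem diag_zero (r : Setoid (Fin 0)) (s : ℕ → Fin 2) : diag r s = 1 := by
  simp [diag]

theorem diag_isLead {n : ℕ} {r : Setoid (Fin n)} (hr : NonCrossing r) :
    ∀ u, IsLead r u → diag r u = 1 := by
  induction hr using NonCrossing.induction with
  | zero r _ => exact fun u _ => diag_zero r u
  | insert m j r hr ih =>
    intro u hu
    rw [isLead_insertPoint] at hu
    rw [diag_insertPoint, hu.1, hu.2.1, ih _ hu.2.2]
    simp [eps]
  | double m j r hr ih =>
    intro u hu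
    rw [isLead_doublePoint] at hu
    rw [diag_doublePoint, hu.1, hu.2.1, ih _ hu.2.2]
    simp [eps]

theorem height_eq_zero_of_diag_ne_zero {n : ℕ} {r : Setoid (Fin n)} (hr : NonCrossing r) :
    ∀ s, diag r s ≠ 0 → height s (2 * n) = 0 := by
  induction hr using NonCrossing.induction with
  | zero r _ => exact fun s _ => rfl
  | insert m j r hr ih =>
    intro s hs
    rw [diag_insertPoint] at hs
    have := j.2
    rw [mul_add, mul_one, ← height_skip_of_ge (eps_ne_zero (left_ne_zero_of_mul hs)) (by omega)]
    exact ih _ (right_ne_zero_of_mul hs)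
  | double m j r hr ih =>
    intro s hs
    rw [diag_doublePoint] at hs
    have := j.2
    rw [mul_add, mul_one, ← height_skip_of_ge (eps_ne_zero (left_ne_zero_of_mul hs)) (by omega)]
    exact ih _ (right_ne_zero_of_mul hs)

/-- A nonzero coefficient forces opposite letters at the ends of each arc, and up-down is the higher
of the two orientations. -/
theorem height_le_of_diag_ne_zero {n : ℕ} {r : Setoid (Fin n)} (hr : NonCrossing r) :
    ∀ s u, diag r s ≠ 0 → IsLead r u → ∀ k ≤ 2 * n, height s k ≤ height u k := by
  induction hr using NonCrossing.induction with
  | zero r _ =>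
    intro s u _ _ k hk
    obtain rfl : k = 0 := by omega
    rfl
  | insert m j r hr ih =>
    intro s u hs hu
    rw [diag_insertPoint] at hs
    rw [isLead_insertPoint] at hu
    have := j.2
    exact height_le_of_skip (N := 2 * m) (by omega) (eps_ne_zero (left_ne_zero_of_mul hs)) hu.1 hu.2.1
      (ih _ _ (right_ne_zero_of_mul hs) hu.2.2)
  | double m j r hr ih =>
    intro s u hs hu
    rw [diag_doublePoint] at hs
    rw [isLead_doublePoint] at hu
    have := j.2
    exact height_le_of_skip (N := 2 * m) (by omega) (eps_ne_zero (left_ne_zero_of_mul hs)) hu.1 hu.2.1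
      (ih _ _ (right_ne_zero_of_mul hs) hu.2.2)

theorem exists_isLead {n : ℕ} (r : Setoid (Fin n)) : ∃ u, IsLead r u := by
  classical
  refine ⟨fun t => if h : t / 2 < n then
    if t % 2 = 0 then if ∀ k, r ⟨t / 2, h⟩ k → ⟨t / 2, h⟩ ≤ k then 0 else 1
    else if ∃ k, r ⟨t / 2, h⟩ k ∧ ⟨t / 2, h⟩ < k then 0 else 1 else 0, fun i => ⟨?_, ?_⟩⟩
  · simp
  · have h1 : (2 * (i : ℕ) + 1) / 2 = i := by omega
    have h2 : (2 * (i : ℕ) + 1) % 2 = 1 := by omega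
    simp [h1, h2]

theorem IsLead.congr {n : ℕ} {r : Setoid (Fin n)} {s u : ℕ → Fin 2} (hs : IsLead r s)
    (h : ∀ i < 2 * n, s i = u i) : IsLead r u := by
  intro i
  have := i.2
  rw [← h _ (by omega), ← h _ (by omega)]
  exact hs i

/-- An up step immediately followed by a down step must be an arc of any noncrossing partition with
this leading word. So the last move in the construction of `r` can also be undone in `r'`. -/
theorem IsLead.unique {n : ℕ} {r r' : Setoid (Fin n)} (hr : NonCrossing r) :
    NonCrossing r' → ∀ u, IsLead r u → IsLead r' u → r = r' := by
  induction hr using NonCrossing.induction with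
  | zero r _ =>
    intro _ _ _ _
    ext a
    exact a.elim0
  | insert m j r hr ih =>
    intro hr' u hu hu'
    have h := (isLead_insertPoint _ _ _).1 hu
    have hj : ∀ k, r' j k → k = j := by
      intro k hk
      refine le_antisymm (not_lt.1 fun hjk => ?_) (((hu' j).1.1 h.1) k hk)
      have := (hu' j).2.2 ⟨k, hk, hjk⟩
      rw [h.2.1] at this
      exact one_ne_zero this
    rw [← insertPoint_comap hj] at hu' ⊢
    rw [isLead_insertPoint] at hu'
    rw [ih (hr'.comap (Fin.strictMono_succAbove j)) _ h.2.2 hu'.2.2]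
  | double m j r hr ih =>
    intro hr' u hu hu'
    have h := (isLead_doublePoint _ _ _).1 hu
    have hj : r' j.castSucc j.succ := by
      -- The letters say that `j` is not last in its class and that its successor is not first in
      -- its own. Unless the two points are directly related, their partners would give a crossing.
      obtain ⟨a, ha, hja⟩ := (hu' j.castSucc).2.1 h.1
      have h2 : ¬ u (2 * (j.succ : Fin (m + 1))) = 0 := by
        rw [← ne_eq, fin_two_ne_zero]
        exact h.2.1
      rw [(hu' j.succ).1] at h2
      push Not at h2
      obtain ⟨b, hb, hbj⟩ := h2
      have ha' : j.succ ≤ a := by rw [Fin.le_def, Fin.val_succ]; exact hja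
      have hb' : b ≤ j.castSucc := by
        rw [Fin.lt_def, Fin.val_succ] at hbj
        rw [Fin.le_def, Fin.val_castSucc]
        omega
      rcases ha'.lt_or_eq with h3 | rfl
      · rcases hb'.lt_or_eq with h4 | rfl
        · have := hr' b j.castSucc j.succ a h4 Fin.castSucc_lt_succ h3 (r'.symm' hb) ha
          exact r'.trans' (r'.symm' this) (r'.symm' hb)
        · exact r'.symm' hb
      · exact ha
    rw [← doublePoint_comap hj] at hu' ⊢
    rw [isLead_doublePoint] at hu'
    rw [ih (hr'.comap (Fin.strictMono_succAbove j.succ)) _ h.2.2 hu'.2.2]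

/-- Every ballot word is the leading word of a noncrossing partition. -/
theorem exists_isLead_of_ballot {n : ℕ} : ∀ u : ℕ → Fin 2, (∀ k ≤ 2 * n, 0 ≤ height u k) →
    height u (2 * n) = 0 → ∃ r : Setoid (Fin n), NonCrossing r ∧ IsLead r u := by
  induction n with
  | zero => exact fun u _ _ => ⟨⊥, fun a => a.elim0, fun a => a.elim0⟩
  | succ m ih =>
    intro u h0 h1
    -- A word without a peak starts with an up step and never comes down, so it cannot end at height
    -- 0.
    have hex : ∃ i < 2 * m + 1, u i = 0 ∧ u (i + 1) = 1 := by
      by_contra! hcon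
      have : ∀ k, k < 2 * (m + 1) → u k = 0 ∧ height u (k + 1) = k + 1 := by
        intro k
        induction k with
        | zero =>
          intro _
          have h2 := h0 1 (by omega)
          rw [height_succ] at h2 ⊢
          by_cases hu : u 0 = 0 <;> simp [hu] at h2 ⊢
        | succ k ihk =>
          intro hk
          obtain ⟨h2, h3⟩ := ihk (by omega)
          have h4 := hcon k (by omega) h2
          have h5 : u (k + 1) = 0 := by
            by_contra h6
            exact h4 (fin_two_ne_zero.1 h6)
          refine ⟨h5, ?_⟩
          rw [height_succ, h3, h5]
          simp
      have h2 : height u (2 * m + 2) = _ := (this (2 * m + 1) (by omega)).2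
      rw [mul_add, mul_one] at h1
      omega
    obtain ⟨i, hi, hu0, hu1⟩ := hex
    have hne : u i ≠ u (i + 1) := by simp [hu0, hu1]
    obtain ⟨r, hr, hlead⟩ := ih (u ∘ skip i)
      (by
        intro k hk
        rcases le_or_gt k i with h2 | h2
        · rw [height_skip_of_le _ h2]
          exact h0 k (by omega)
        · rw [height_skip_of_ge hne h2.le]
          exact h0 _ (by omega))
      (by
        rw [height_skip_of_ge hne (by omega)]
        exact h1)
    -- The parity of the peak decides whether its arc closes up one box or links two neighbouring
    -- ones.
    obtain ⟨j, rfl | rfl⟩ : ∃ j, i = 2 * j ∨ i = 2 * j + 1 := ⟨i / 2, by omega⟩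
    · exact ⟨insertPoint ⟨j, by omega⟩ r, hr.insertPoint _,
        (isLead_insertPoint _ _ _).2 ⟨hu0, hu1, hlead⟩⟩
    · exact ⟨doublePoint ⟨j, by omega⟩ r, hr.doublePoint _,
        (isLead_doublePoint _ _ _).2 ⟨hu0, hu1, hlead⟩⟩

/-! ### The dual canonical basis of the invariants of `V₁^{⊗2n}` -/

theorem coeff₁_emptyDiagram (s : ℕ → Fin 2) : coeff₁ 0 s emptyDiagram = 1 := by
  rw [emptyDiagram, coeff₁_basis, if_pos (Subsingleton.elim _ _)]

/-- Each move is an arc insertion. The induction does not control its place, so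
`dualCanonicalV1_cup` is needed for arcs right of the middle. -/
theorem exists_mem_dualCanonicalV1 {n : ℕ} {r : Setoid (Fin n)} (hr : NonCrossing r) :
    ∃ x ∈ dualCanonicalV1 n, ∀ s, coeff₁ (2 * n) s x = diag r s := by
  induction hr using NonCrossing.induction with
  | zero r _ =>
    refine ⟨emptyDiagram, rfl, fun s => ?_⟩
    exact (coeff₁_emptyDiagram s).trans (diag_zero _ _).symm
  | insert m j r hr ih =>
    obtain ⟨x, hx, h⟩ := ih
    refine ⟨_, dualCanonicalV1_cup hx (i := 2 * j) (by omega), fun s => ?_⟩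
    rw [diag_insertPoint, ← h]
    exact coeff₁_cup _ _ _ _
  | double m j r hr ih =>
    obtain ⟨x, hx, h⟩ := ih
    refine ⟨_, dualCanonicalV1_cup hx (i := 2 * j + 1) (by omega), fun s => ?_⟩
    rw [diag_doublePoint, ← h]
    exact coeff₁_cup _ _ _ _

theorem exists_diag_of_mem_dualCanonicalV1 {n : ℕ} : ∀ x ∈ dualCanonicalV1 n,
    ∃ r : Setoid (Fin n), NonCrossing r ∧ ∀ s, coeff₁ (2 * n) s x = diag r s := by
  induction n with
  | zero =>
    rintro x rfl
    exact ⟨⊥, fun a => a.elim0, fun s => (coeff₁_emptyDiagram s).trans (diag_zero _ _).symm⟩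
  | succ m ih =>
    rintro _ ⟨x, hx, i, hi, rfl⟩
    obtain ⟨r, hr, h⟩ := ih x hx
    obtain ⟨j, rfl | rfl⟩ : ∃ j, i = 2 * j ∨ i = 2 * j + 1 := ⟨i / 2, by omega⟩
    · refine ⟨insertPoint ⟨j, by omega⟩ r, hr.insertPoint _, fun s => ?_⟩
      rw [diag_insertPoint, ← h]
      exact coeff₁_cup _ _ _ _
    · refine ⟨doublePoint ⟨j, by omega⟩ r, hr.doublePoint _, fun s => ?_⟩
      rw [diag_doublePoint, ← h]
      exact coeff₁_cup _ _ _ _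

/-! ### Coefficients with respect to the standard basis of `V₂^{⊗n}` -/

/-- The basis of `V₂^{⊗n}` consisting of the tensors of the standard basis vectors. -/
def V2basis (n : ℕ) : Module.Basis (Fin n → Fin 3) Cq (V2Pow n) :=
  Basis.piTensorProduct (fun _ : Fin n => Pi.basisFun Cq (Fin 3))

/-- The coefficient of `x ∈ V₂^{⊗n}` at the first `n` letters of the word `w`. -/
def coeff₂ (n : ℕ) (w : ℕ → Fin 3) : V2Pow n →ₗ[Cq] Cq := (V2basis n).coord fun i => w i

theorem coeff₂_tprod (n : ℕ) (w : ℕ → Fin 3) (g : Fin n → V2) :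
    coeff₂ n w (PiTensorProduct.tprod Cq g) = ∏ i, g i (w i) := by
  simp [coeff₂, V2basis, Basis.piTensorProduct_repr_tprod_apply]

theorem coeff₂_congr {n : ℕ} {w t : ℕ → Fin 3} (h : ∀ i < n, w i = t i) :
    coeff₂ n w = coeff₂ n t := by
  unfold coeff₂
  congr 1
  funext i
  exact h i i.2

theorem ext_coeff₂ {n : ℕ} {x y : V2Pow n} (h : ∀ w, coeff₂ n w x = coeff₂ n w y) : x = y := by
  refine (V2basis n).ext_elem fun t => ?_
  simpa [coeff₂] using h (extend t)

/-- The component of a tensor at the basis vector `a` of its last factor, on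
`V₂^{⊗n} ⊗ V₂`. -/
def lastComponent (n : ℕ) (a : Fin 3) : V2Pow n ⊗[Cq] V2 →ₗ[Cq] V2Pow n :=
  (TensorProduct.rid Cq (V2Pow n)).toLinearMap ∘ₗ LinearMap.lTensor (V2Pow n) (LinearMap.proj a)

/-- The component of a tensor at the basis vector `a` of its last factor. -/
def component (n : ℕ) (a : Fin 3) : V2Pow (n + 1) →ₗ[Cq] V2Pow n :=
  lastComponent n a ∘ₗ (snocEquiv n).symm.toLinearMap

@[simp] theorem lastComponent_tmul (n : ℕ) (a : Fin 3) (z : V2Pow n) (v : V2) :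
    lastComponent n a (z ⊗ₜ v) = v a • z := by
  simp [lastComponent]

theorem snocEquiv_tprod (n : ℕ) (f : Fin n → V2) (v : V2) :
    snocEquiv n (PiTensorProduct.tprod Cq f ⊗ₜ v) =
      PiTensorProduct.tprod Cq (Fin.snoc f v : Fin (n + 1) → V2) := by
  rw [← Fin.append_right_eq_snoc f fun _ : Fin 1 => v]
  have h := TensorPower.tprod_mul_tprod Cq f fun _ : Fin 1 => v
  rw [TensorPower.gMul_def] at h
  rw [← h]
  simp only [snocEquiv, LinearEquiv.trans_apply, TensorProduct.congr_tmul, LinearEquiv.refl_apply]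
  congr 2
  rw [LinearEquiv.symm_apply_eq, PiTensorProduct.subsingletonEquiv_apply_tprod]

theorem coeff₂_succ (n : ℕ) (w : ℕ → Fin 3) (x : V2Pow (n + 1)) :
    coeff₂ (n + 1) w x = coeff₂ n w (component n (w n) x) := by
  suffices h : coeff₂ (n + 1) w = coeff₂ n w ∘ₗ component n (w n) from LinearMap.congr_fun h x
  refine PiTensorProduct.ext (MultilinearMap.ext fun g => ?_)
  have hg : PiTensorProduct.tprod Cq g = snocEquiv n (PiTensorProduct.tprod Cq
      (fun i : Fin n => g i.castSucc) ⊗ₜ g (Fin.last n)) := by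
    rw [snocEquiv_tprod]
    congr 1
    exact (Fin.snoc_init_self g).symm
  simp only [LinearMap.compMultilinearMap_apply, LinearMap.comp_apply]
  rw [coeff₂_tprod, hg, component, LinearMap.comp_apply, LinearEquiv.coe_coe,
    LinearEquiv.symm_apply_apply, lastComponent_tmul, map_smul, coeff₂_tprod,
    Fin.prod_univ_castSucc, smul_eq_mul, mul_comm]
  rfl

theorem eq_zero_of_component {n : ℕ} {x : V2Pow (n + 1)} (h : ∀ a, component n a x = 0) :
    x = 0 :=
  ext_coeff₂ fun w => by rw [coeff₂_succ, h, map_zero, map_zero]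

/-! ### The action of the generators on `V₂^{⊗n}` -/

theorem V2rep_apply (x : UqGen) (v : V2) (a : Fin 3) :
    V2rep (uq x) v a = ∑ b, V2mat x a b * v b := by
  simp [V2rep, uqLift_uq, Matrix.mulVec, dotProduct]

theorem comul_uq (x : UqGen) : comul (uq x) = comulGen x := uqLift_uq _ _ _ _ _ _ _

theorem counit_uq (x : UqGen) :
    counit (uq x) = match x with | .E => 0 | .F => 0 | .K => 1 | .Kinv => 1 :=
  uqLift_uq _ _ _ _ _ _ _

theorem powRep_zero (u : Uq) (x : V2Pow 0) : powRep 0 u x = counit u • x := by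
  simp [powRep, Algebra.ofId_apply, Module.algebraMap_end_apply]

theorem component_powRep (n : ℕ) (a : Fin 3) (u : Uq) (x : V2Pow (n + 1)) :
    component n a (powRep (n + 1) u x) =
      lastComponent n a (tensorRep (powRep n) V2rep u ((snocEquiv n).symm x)) := by
  simp [component, powRep, LinearEquiv.conjAlgEquiv_apply]

theorem tensorRep_uq {M N : Type} [AddCommGroup M] [Module Cq M] [AddCommGroup N] [Module Cq N]
    (ρ : Uq →ₐ[Cq] Module.End Cq M) (σ : Uq →ₐ[Cq] Module.End Cq N) (x : UqGen) (z : M) (v : N) :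
    tensorRep ρ σ (uq x) (z ⊗ₜ v) = match x with
      | .E => ρ (uq .E) z ⊗ₜ v + ρ (uq .Kinv) z ⊗ₜ σ (uq .E) v
      | .F => ρ (uq .F) z ⊗ₜ σ (uq .K) v + z ⊗ₜ σ (uq .F) v
      | .K => ρ (uq .K) z ⊗ₜ σ (uq .K) v
      | .Kinv => ρ (uq .Kinv) z ⊗ₜ σ (uq .Kinv) v := by
  cases x <;> simp [tensorRep, comul_uq, comulGen, Module.endTensorEndAlgHom_apply]

/-- Sorting by the last tensor factor turns the equation for a highest weight vector into a
triangular system, which is solved from the lowest component upwards in `eq_zero_of_coeff₂`. -/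
theorem component_E (n : ℕ) (a : Fin 3) (x : V2Pow (n + 1)) :
    component n a (powRep (n + 1) (uq .E) x) = powRep n (uq .E) (component n a x) +
      ∑ b, V2mat .E a b • powRep n (uq .Kinv) (component n b x) := by
  rw [component_powRep]
  simp only [component, LinearMap.comp_apply, LinearEquiv.coe_coe]
  induction (snocEquiv n).symm x with
  | zero => simp
  | add y z hy hz =>
    simp only [map_add, hy, hz, smul_add, Finset.sum_add_distrib]
    abel
  | tmul z v =>
    simp only [tensorRep_uq, map_add, lastComponent_tmul, V2rep_apply, Finset.sum_smul, map_smul,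
      smul_smul]

theorem component_F (n : ℕ) (a : Fin 3) (x : V2Pow (n + 1)) :
    component n a (powRep (n + 1) (uq .F) x) =
      ∑ b, V2mat .K a b • powRep n (uq .F) (component n b x) +
      ∑ b, V2mat .F a b • component n b x := by
  rw [component_powRep]
  simp only [component, LinearMap.comp_apply, LinearEquiv.coe_coe]
  induction (snocEquiv n).symm x with
  | zero => simp
  | add y z hy hz =>
    simp only [map_add, hy, hz, smul_add, Finset.sum_add_distrib]
    abel
  | tmul z v =>
    simp only [tensorRep_uq, map_add, lastComponent_tmul, V2rep_apply, Finset.sum_smul, map_smul,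
      smul_smul]

theorem component_K (n : ℕ) (a : Fin 3) (x : V2Pow (n + 1)) :
    component n a (powRep (n + 1) (uq .K) x) =
      ∑ b, V2mat .K a b • powRep n (uq .K) (component n b x) := by
  rw [component_powRep]
  simp only [component, LinearMap.comp_apply, LinearEquiv.coe_coe]
  induction (snocEquiv n).symm x with
  | zero => simp
  | add y z hy hz => simp only [map_add, hy, hz, smul_add, Finset.sum_add_distrib]
  | tmul z v =>
    simp only [tensorRep_uq, lastComponent_tmul, V2rep_apply, Finset.sum_smul, map_smul,
      smul_smul]

/-- The weights of the standard basis vectors of `V₂`, divided by `2`. -/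
def weight : Fin 3 → ℤ := ![1, 0, -1]

theorem component_K' (n : ℕ) (a : Fin 3) (x : V2Pow (n + 1)) :
    component n a (powRep (n + 1) (uq .K) x) =
      q ^ (2 * weight a) • powRep n (uq .K) (component n a x) := by
  rw [component_K]
  fin_cases a <;> simp [V2mat, weight, Fin.sum_univ_three]

theorem powRep_Kinv_of_K {n : ℕ} {x : V2Pow n} {c : Cq} (hc : c ≠ 0)
    (h : powRep n (uq .K) x = c • x) : powRep n (uq .Kinv) x = c⁻¹ • x := by
  have h1 : powRep n (uq .Kinv) (powRep n (uq .K) x) = x := by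
    rw [← Module.End.mul_apply, ← map_mul, uq_Kinv_K, map_one, Module.End.one_apply]
  rw [h, map_smul] at h1
  rw [← h1, smul_smul, inv_mul_cancel₀ hc, one_smul, h1]

theorem powRep_K_F (n : ℕ) (x : V2Pow n) : powRep n (uq .K) (powRep n (uq .F) x) =
    (q ^ 2)⁻¹ • powRep n (uq .F) (powRep n (uq .K) x) := by
  rw [← Module.End.mul_apply, ← map_mul, uq_K_F, map_smul, map_mul]
  rfl

theorem powRep_E_F (n : ℕ) (x : V2Pow n) : powRep n (uq .E) (powRep n (uq .F) x) =
    powRep n (uq .F) (powRep n (uq .E) x) +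
      (q - q⁻¹)⁻¹ • (powRep n (uq .K) x - powRep n (uq .Kinv) x) := by
  have h := congrArg (fun u => powRep n u x) uq_E_F
  simp only [map_sub, map_mul, map_smul, LinearMap.sub_apply, Module.End.mul_apply,
    LinearMap.smul_apply] at h
  rw [← h]
  abel

/-! ### Highest weight vectors and invariants -/

theorem q_pow_ne_one {m : ℕ} (hm : m ≠ 0) : q ^ m ≠ 1 := by
  intro h
  have h1 : algebraMap (Polynomial ℂ) (RatFunc ℂ) (Polynomial.X ^ m) =
      algebraMap (Polynomial ℂ) (RatFunc ℂ) 1 := by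
    simpa [q, RatFunc.algebraMap_X] using h
  have h3 := congrArg Polynomial.natDegree (RatFunc.algebraMap_injective ℂ h1)
  simp [hm] at h3

theorem q_zpow_ne_one {m : ℤ} (hm : m ≠ 0) : q ^ m ≠ 1 := by
  intro h
  refine q_pow_ne_one (Int.natAbs_ne_zero.2 hm) ?_
  rcases Int.natAbs_eq m with h1 | h1
  · rw [h1, zpow_natCast] at h
    exact h
  · rw [h1, zpow_neg, zpow_natCast, inv_eq_one] at h
    exact h

/-- Each tensor factor shifts the exponent of the weight by at most 2, and with no factors left only
weight 0 survives because `q` is not a root of unity. -/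
theorem eq_zero_of_weight {n : ℕ} {x : V2Pow n} {m : ℤ} (hm : 2 * (n : ℤ) < |m|)
    (h : powRep n (uq .K) x = q ^ m • x) : x = 0 := by
  induction n generalizing m with
  | zero =>
    rw [powRep_zero, counit_uq, one_smul] at h
    have hne : 1 - q ^ m ≠ 0 := sub_ne_zero.2 (q_zpow_ne_one (by rintro rfl; simp at hm)).symm
    refine (smul_eq_zero.1 ?_).resolve_left hne
    rw [sub_smul, one_smul, ← h, sub_self]
  | succ n ih =>
    refine eq_zero_of_component fun a => ih (m := m - 2 * weight a) ?_ ?_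
    · have : |weight a| ≤ 1 := by fin_cases a <;> simp [weight]
      rw [abs_le] at this
      push_cast at hm
      rw [lt_abs] at hm ⊢
      omega
    · have h1 := congrArg (component n a) h
      rw [component_K', map_smul] at h1
      rw [zpow_sub₀ q_ne_zero, div_eq_inv_mul, ← smul_smul, ← h1, smul_smul,
        inv_mul_cancel₀ (zpow_ne_zero _ q_ne_zero), one_smul]

theorem smul_sub_smul {R M : Type*} [CommRing R] [AddCommGroup M] [Module R M] (a b c : R) (x : M) :
    a • (b • x - c • x) = (a * (b - c)) • x := by
  module

/-- A highest weight vector of weight `0` is invariant. -/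
theorem powRep_F_eq_zero {n : ℕ} {x : V2Pow n} (hE : powRep n (uq .E) x = 0)
    (hK : powRep n (uq .K) x = x) : powRep n (uq .F) x = 0 := by
  let y : ℕ → V2Pow n := fun j => (powRep n (uq .F))^[j] x
  have hy : ∀ j, y (j + 1) = powRep n (uq .F) (y j) := fun j =>
    Function.iterate_succ_apply' _ _ _
  have hKy : ∀ j, powRep n (uq .K) (y j) = ((q ^ 2)⁻¹) ^ j • y j := by
    intro j
    induction j with
    | zero => rw [pow_zero, one_smul]; exact hK
    | succ j ih => rw [hy, powRep_K_F, ih, map_smul, smul_smul, ← pow_succ']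
  have hq := q_ne_zero
  have hq1 := q_sub_inv_ne_zero
  -- The usual `sl₂` coefficient `-[j][j+1]` with which `E` lowers the power of `F` on a vector of
  -- highest weight 0.
  let c : ℕ → Cq := fun j => -((q ^ j - (q ^ j)⁻¹) * (q ^ (j + 1) - (q ^ (j + 1))⁻¹)) *
    ((q - q⁻¹) ^ 2)⁻¹
  have hEy : ∀ j, powRep n (uq .E) (y (j + 1)) = c j • y j := by
    intro j
    have hstep : ∀ j, powRep n (uq .E) (y (j + 1)) = powRep n (uq .F) (powRep n (uq .E) (y j)) +
        ((q - q⁻¹)⁻¹ * (((q ^ 2)⁻¹) ^ j - (((q ^ 2)⁻¹) ^ j)⁻¹)) • y j := by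
      intro j
      rw [hy, powRep_E_F, powRep_Kinv_of_K (by simp [hq]) (hKy j), hKy]
      exact congrArg _ (smul_sub_smul _ _ _ _)
    induction j with
    | zero =>
      rw [hstep]
      have : y 0 = x := rfl
      simp [this, hE, c]
    | succ j ih =>
      rw [hstep, ih, map_smul, ← hy, ← add_smul]
      congr 1
      simp only [c]
      have h1 : (q - q⁻¹)⁻¹ = (q - q⁻¹) * ((q - q⁻¹) ^ 2)⁻¹ := by field_simp
      rw [h1, mul_assoc, mul_comm (((q - q⁻¹) ^ 2)⁻¹), ← mul_assoc, ← add_mul]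
      congr 1
      rw [inv_pow, inv_inv, ← pow_mul, pow_succ q (j + 1), pow_succ q j, mul_comm 2, pow_mul,
        pow_succ q j]
      field_simp
      ring
  have hc : ∀ j, c (j + 1) ≠ 0 := by
    intro j
    have h2 : ∀ m : ℕ, m ≠ 0 → q ^ m - (q ^ m)⁻¹ ≠ 0 := by
      intro m hm h
      have h3 : q ^ m * q ^ m = 1 := by
        nth_rewrite 2 [sub_eq_zero.1 h]
        exact mul_inv_cancel₀ (pow_ne_zero _ hq)
      rw [← pow_add] at h3
      exact q_pow_ne_one (by omega) h3
    simp only [c]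
    exact mul_ne_zero (neg_ne_zero.2 (mul_ne_zero (h2 _ (by omega)) (h2 _ (by omega))))
      (inv_ne_zero (pow_ne_zero _ hq1))
  -- Applying `E` carries the vanishing down one power of `F` at a time. The descent ends at `F x`,
  -- since `c 0 = 0`.
  have hzero : ∀ j, y (j + 1) = 0 → y 1 = 0 := by
    intro j
    induction j with
    | zero => exact id
    | succ j ih =>
      intro h
      have := hEy (j + 1)
      rw [h, map_zero] at this
      exact ih ((smul_eq_zero.1 this.symm).resolve_left (hc j))
  -- The vector `F^(n+1) x` has weight exponent `-2(n+1)`, just outside the possible range.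
  refine hzero n (eq_zero_of_weight (m := -(2 * (n + 1 : ℕ))) ?_ ?_)
  · rw [abs_neg, abs_of_nonneg (by positivity)]
    push_cast
    omega
  · rw [hKy, inv_pow, ← pow_mul, zpow_neg]
    norm_cast

/-- Finite dimensionality gives the condition on `F` for free by `powRep_F_eq_zero`, and the vectors
acted on through the counit need only be tested on generators. -/
theorem mem_Inv_iff {n : ℕ} {x : V2Pow n} :
    x ∈ Inv n ↔ powRep n (uq .E) x = 0 ∧ powRep n (uq .K) x = x := by
  constructor
  · intro h
    exact ⟨by rw [h, counit_uq, zero_smul], by rw [h, counit_uq, one_smul]⟩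
  · rintro ⟨hE, hK⟩ u
    obtain ⟨u, rfl⟩ := RingQuot.mkAlgHom_surjective Cq UqRel u
    induction u using FreeAlgebra.induction with
    | grade0 r => simp [AlgHom.commutes, Module.algebraMap_end_apply]
    | grade1 g =>
      change powRep n (uq g) x = counit (uq g) • x
      rw [counit_uq]
      cases g with
      | E => simpa using hE
      | F => simpa using powRep_F_eq_zero hE hK
      | K => simpa using hK
      | Kinv => simpa using powRep_Kinv_of_K one_ne_zero (by simpa using hK)
    | mul a b ha hb => rw [map_mul, map_mul, Module.End.mul_apply, hb, map_smul, ha, map_mul,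
        smul_smul, mul_comm]
    | add a b ha hb => rw [map_add, map_add, LinearMap.add_apply, ha, hb, map_add, add_smul]

/-! ### Riordan paths detect highest weight vectors -/

/-- The word `w` describes a path of length `n` from height `0` to height `k` that has no flat step
at height `0` and does not go below `0`. -/
def IsRiordanPath : ℕ → (ℕ → Fin 3) → ℕ → Prop
  | 0, _, k => k = 0
  | n + 1, w, k => match w n with
    | 0 => ∃ k', k = k' + 1 ∧ IsRiordanPath n w k'
    | 1 => k ≠ 0 ∧ IsRiordanPath n w k
    | 2 => IsRiordanPath n w (k + 1)

theorem isRiordanPath_congr {n : ℕ} {w w' : ℕ → Fin 3} {k : ℕ} (h : ∀ i < n, w i = w' i)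
    (hw : IsRiordanPath n w k) : IsRiordanPath n w' k := by
  induction n generalizing k with
  | zero => exact hw
  | succ n ih =>
    simp only [IsRiordanPath] at hw ⊢
    rw [← h n (by omega)]
    have ih := fun k => ih (k := k) fun i hi => h i (by omega)
    split at hw
    · obtain ⟨k', rfl, h⟩ := hw
      exact ⟨k', rfl, ih _ h⟩
    · exact ⟨hw.1, ih _ hw.2⟩
    · exact ih _ hw

/-- A highest weight vector whose coefficients at all paths vanish is zero. -/
theorem eq_zero_of_coeff₂ {n : ℕ} {x : V2Pow n} {k : ℕ} (hE : powRep n (uq .E) x = 0)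
    (hK : powRep n (uq .K) x = q ^ (2 * (k : ℤ)) • x)
    (h : ∀ w, IsRiordanPath n w k → coeff₂ n w x = 0) : x = 0 := by
  induction n generalizing k with
  | zero =>
    rcases Nat.eq_zero_or_pos k with rfl | hk
    · exact ext_coeff₂ fun w => by rw [h w rfl, map_zero]
    · exact eq_zero_of_weight (by rw [lt_abs]; left; push_cast; omega) hK
  | succ n ih =>
    have hw : ∀ (w : ℕ → Fin 3) (a : Fin 3), coeff₂ (n + 1) (Function.update w n a) x =
        coeff₂ n w (component n a x) := by
      intro w a
      rw [coeff₂_succ, Function.update_self]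
      refine LinearMap.congr_fun (coeff₂_congr fun i hi => ?_) _
      rw [Function.update_of_ne (by omega)]
    have hp : ∀ (w : ℕ → Fin 3) (a : Fin 3) (k : ℕ), IsRiordanPath n w k →
        IsRiordanPath n (Function.update w n a) k := fun w a k =>
      isRiordanPath_congr fun i hi => by rw [Function.update_of_ne (by omega)]
    have hKc : ∀ a, powRep n (uq .K) (component n a x) =
        q ^ (2 * ((k : ℤ) - weight a)) • component n a x := by
      intro a
      have h1 := congrArg (component n a) hK
      rw [component_K', map_smul] at h1
      rw [mul_sub, zpow_sub₀ q_ne_zero, div_eq_inv_mul, ← smul_smul, ← h1, smul_smul,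
        inv_mul_cancel₀ (zpow_ne_zero _ q_ne_zero), one_smul]
    have hEc : ∀ a, powRep n (uq .E) (component n a x) +
        ∑ b, V2mat .E a b • powRep n (uq .Kinv) (component n b x) = 0 := by
      intro a
      rw [← component_E, hE, map_zero]
    -- The lowest row of `E` is zero, so this component is itself a highest weight vector, now of
    -- weight `k + 1`. Once it vanishes, the next component becomes a highest weight vector too.
    have h2 : component n 2 x = 0 := by
      refine ih (k := k + 1) ?_ ?_ fun w hp' => ?_
      · simpa [V2mat, Fin.sum_univ_three] using hEc 2
      · rw [hKc]
        simp [weight]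
      · rw [← hw, h]
        simp only [IsRiordanPath, Function.update_self]
        exact hp _ _ _ hp'
    have hE1 : powRep n (uq .E) (component n 1 x) = 0 := by
      simpa [V2mat, Fin.sum_univ_three, h2] using hEc 1
    -- At height 0 the vector is also killed by `F`, which makes the other two components vanish
    -- without any test. This is why paths need no flat step at height 0.
    rcases k with _ | k
    · have hF := powRep_F_eq_zero hE (by simpa using hK)
      have hFc : ∀ a, ∑ b, V2mat .K a b • powRep n (uq .F) (component n b x) +
          ∑ b, V2mat .F a b • component n b x = 0 := by
        intro a
        rw [← component_F, hF, map_zero]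
      have h1 : component n 1 x = 0 := by
        simpa [V2mat, Fin.sum_univ_three, h2, qTwo_ne_zero] using hFc 2
      have h0 : component n 0 x = 0 := by
        simpa [V2mat, Fin.sum_univ_three, h1] using hFc 1
      refine eq_zero_of_component fun a => ?_
      fin_cases a
      exacts [h0, h1, h2]
    · have h1 : component n 1 x = 0 := by
        refine ih (k := k + 1) hE1 ?_ fun w hp' => ?_
        · rw [hKc]
          simp [weight]
        · rw [← hw, h]
          simp only [IsRiordanPath, Function.update_self]
          exact ⟨by omega, hp _ _ _ hp'⟩
      have h0 : component n 0 x = 0 := by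
        refine ih (k := k) ?_ ?_ fun w hp' => ?_
        · simpa [V2mat, Fin.sum_univ_three, h1] using hEc 0
        · rw [hKc]
          simp [weight]
        · rw [← hw, h]
          simp only [IsRiordanPath, Function.update_self]
          exact ⟨k, rfl, hp _ _ _ hp'⟩
      refine eq_zero_of_component fun a => ?_
      fin_cases a
      exacts [h0, h1, h2]

/-! ### Sums over words -/

/-- The sum of the values of `f` at the words of length `m`, extended by zeros. -/
def wordSum (m : ℕ) (f : (ℕ → Fin 2) → Cq) : Cq := ∑ s : Fin m → Fin 2, f (extend s)

theorem extend_snoc {m : ℕ} (s : Fin m → Fin 2) (c : Fin 2) :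
    extend (Fin.snoc s c : Fin (m + 1) → Fin 2) = Function.update (extend s) m c := by
  funext i
  rcases lt_trichotomy i m with h | rfl | h
  · rw [Function.update_of_ne h.ne]
    have : i < m + 1 := by omega
    simp [extend, h, this, Fin.snoc]
  · simp [extend, Fin.snoc]
  · rw [Function.update_of_ne h.ne']
    have h1 : ¬ i < m + 1 := by omega
    have h2 : ¬ i < m := by omega
    simp [extend, h1, h2]

theorem wordSum_succ (m : ℕ) (f : (ℕ → Fin 2) → Cq) :
    wordSum (m + 1) f = ∑ c, wordSum m fun s => f (Function.update s m c) := by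
  simp only [wordSum, ← extend_snoc]
  rw [← Fintype.sum_prod_type']
  exact (Fintype.sum_equiv (Fin.snocEquiv fun _ : Fin (m + 1) => Fin 2) _ _ fun _ => rfl).symm

theorem wordSum_add (m : ℕ) (f g : (ℕ → Fin 2) → Cq) :
    wordSum m (fun s => f s + g s) = wordSum m f + wordSum m g :=
  Finset.sum_add_distrib

theorem wordSum_mul_left (m : ℕ) (c : Cq) (f : (ℕ → Fin 2) → Cq) :
    wordSum m (fun s => c * f s) = c * wordSum m f :=
  (Finset.mul_sum _ _ _).symm

/-! ### The map `π₂^{⊗n}` in coefficients -/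

/-- The coefficient of `⨂ᵢ π₂(s(2i) ⊗ s(2i+1))` at the word `w`. -/
def boxWeight (n : ℕ) (s : ℕ → Fin 2) (w : ℕ → Fin 3) : Cq :=
  ∏ i ∈ Finset.range n, boxVec (s (2 * i)) (s (2 * i + 1)) (w i)

/-- The map `π₂^{⊗n}` on coefficient functions. -/
def boxSum (n : ℕ) (X : (ℕ → Fin 2) → Cq) (w : ℕ → Fin 3) : Cq :=
  wordSum (2 * n) fun s => boxWeight n s w * X s

theorem coeff₂_boxes (n : ℕ) (w : ℕ → Fin 3) (x : V1Pow (2 * n)) :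
    coeff₂ n w (boxes n x) = boxSum n (fun s => coeff₁ (2 * n) s x) w := by
  rw [boxes, Module.Basis.constr_apply_fintype, map_sum]
  refine Finset.sum_congr rfl fun s _ => ?_
  beta_reduce
  rw [map_smul, coeff₂_tprod, smul_eq_mul, mul_comm, boxWeight, Finset.prod_range]
  congr 1
  · refine Finset.prod_congr rfl fun i _ => ?_
    have h1 := extend_apply s ⟨2 * i, by omega⟩
    have h2 := extend_apply s ⟨2 * i + 1, by omega⟩
    simp only at h1 h2
    rw [h1, h2]
  · simp [coeff₁]

theorem boxWeight_congr {n : ℕ} {s : ℕ → Fin 2} {w w' : ℕ → Fin 3} (h : ∀ i < n, w i = w' i) :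
    boxWeight n s w = boxWeight n s w' :=
  Finset.prod_congr rfl fun i hi => by rw [h i (Finset.mem_range.1 hi)]

theorem boxSum_congr {n : ℕ} {X : (ℕ → Fin 2) → Cq} {w w' : ℕ → Fin 3}
    (h : ∀ i < n, w i = w' i) : boxSum n X w = boxSum n X w' := by
  simp only [boxSum, boxWeight_congr h]

theorem boxSum_add (n : ℕ) (X Y : (ℕ → Fin 2) → Cq) (w : ℕ → Fin 3) :
    boxSum n (fun s => X s + Y s) w = boxSum n X w + boxSum n Y w := by
  simp only [boxSum, mul_add, wordSum_add]

theorem boxSum_mul_left (n : ℕ) (c : Cq) (X : (ℕ → Fin 2) → Cq) (w : ℕ → Fin 3) :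
    boxSum n (fun s => c * X s) w = c * boxSum n X w := by
  simp only [boxSum, mul_left_comm _ c, wordSum_mul_left]

/-- Replacement of the letters `l` and `l + 1`. -/
def setPair (l : ℕ) (c d : Fin 2) (s : ℕ → Fin 2) : ℕ → Fin 2 :=
  Function.update (Function.update s l c) (l + 1) d

@[simp] theorem setPair_left (l : ℕ) (c d : Fin 2) (s : ℕ → Fin 2) : setPair l c d s l = c := by
  simp [setPair]

@[simp] theorem setPair_right (l : ℕ) (c d : Fin 2) (s : ℕ → Fin 2) :
    setPair l c d s (l + 1) = d := by
  simp [setPair]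

theorem setPair_of_lt {l i : ℕ} (h : i < l) (c d : Fin 2) (s : ℕ → Fin 2) :
    setPair l c d s i = s i := by
  rw [setPair, Function.update_of_ne (by omega), Function.update_of_ne (by omega)]

theorem boxSum_succ (n : ℕ) (X : (ℕ → Fin 2) → Cq) (w : ℕ → Fin 3) :
    boxSum (n + 1) X w = ∑ c, ∑ d, boxVec c d (w n) *
      boxSum n (fun s => X (setPair (2 * n) c d s)) w := by
  have h : boxSum (n + 1) X w = ∑ d, ∑ c, wordSum (2 * n) fun s =>
      boxWeight (n + 1) (setPair (2 * n) c d s) w * X (setPair (2 * n) c d s) := by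
    rw [boxSum, mul_add, mul_one, wordSum_succ]
    refine Finset.sum_congr rfl fun d _ => ?_
    rw [wordSum_succ]
    rfl
  rw [h, Finset.sum_comm]
  refine Finset.sum_congr rfl fun c _ => Finset.sum_congr rfl fun d _ => ?_
  rw [boxSum, ← wordSum_mul_left]
  congr 1
  funext s
  have h1 : boxWeight n (setPair (2 * n) c d s) w = boxWeight n s w :=
    Finset.prod_congr rfl fun i hi => by
      have := Finset.mem_range.1 hi
      rw [setPair_of_lt (by omega), setPair_of_lt (by omega)]
  rw [boxWeight, Finset.prod_range_succ, ← boxWeight, h1, setPair_left, setPair_right]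
  ring

/-- The index of the basis vector of `V₂` proportional to `π₂(v^c ⊗ v^d)`. -/
def letter : Fin 2 → Fin 2 → Fin 3
  | 0, 0 => 0
  | 1, 1 => 2
  | _, _ => 1

theorem boxVec_ne_zero_iff {c d : Fin 2} {a : Fin 3} : boxVec c d a ≠ 0 ↔ a = letter c d := by
  have := q_ne_zero
  have := qTwo_ne_zero
  fin_cases c <;> fin_cases d <;> fin_cases a <;> simp_all [boxVec, letter]

theorem boxWeight_ne_zero_iff {n : ℕ} {s : ℕ → Fin 2} {w : ℕ → Fin 3} :
    boxWeight n s w ≠ 0 ↔ ∀ i < n, w i = letter (s (2 * i)) (s (2 * i + 1)) := by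
  simp only [boxWeight, Finset.prod_ne_zero_iff, boxVec_ne_zero_iff, Finset.mem_range]

/-- The weight, divided by `2`, of the first `k` letters of a word in the basis vectors of `V₂`. -/
def totalWeight (w : ℕ → Fin 3) (k : ℕ) : ℤ := ∑ i ∈ Finset.range k, weight (w i)

theorem totalWeight_succ (w : ℕ → Fin 3) (k : ℕ) :
    totalWeight w (k + 1) = totalWeight w k + weight (w k) :=
  Finset.sum_range_succ _ _

/-- A box remembers the total weight of its two strands, so the heights at even places depend only
on the image word. -/
theorem height_two_mul {n : ℕ} {s : ℕ → Fin 2} {w : ℕ → Fin 3}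
    (h : ∀ i < n, w i = letter (s (2 * i)) (s (2 * i + 1))) :
    ∀ k ≤ n, height s (2 * k) = 2 * totalWeight w k := by
  intro k
  induction k with
  | zero => intro _; rfl
  | succ k ih =>
    intro hk
    rw [mul_add, mul_one, height_succ, height_succ, ih (by omega), totalWeight_succ, h k hk,
      mul_add, add_assoc]
    congr 1
    generalize s (2 * k) = a
    generalize s (2 * k + 1) = b
    fin_cases a <;> fin_cases b <;> simp [letter, weight]

/-! ### Compatibility with the action -/

/-- The action of `E` on coefficient functions on words in the basis vectors of `V₁`. -/
def actE₁ (m : ℕ) (X : (ℕ → Fin 2) → Cq) (s : ℕ → Fin 2) : Cq :=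
  ∑ i ∈ Finset.range m, if s i = 0 then q ^ (-height s i) * X (Function.update s i 1) else 0

/-- The action of `E` on coefficient functions on words in the basis vectors of `V₂`. -/
def actE₂ (n : ℕ) (Y : (ℕ → Fin 3) → Cq) (w : ℕ → Fin 3) : Cq :=
  ∑ i ∈ Finset.range n, q ^ (-(2 * totalWeight w i)) *
    ∑ b, V2mat .E (w i) b * Y (Function.update w i b)

theorem coeff₂_K (n : ℕ) (w : ℕ → Fin 3) (x : V2Pow n) :
    coeff₂ n w (powRep n (uq .K) x) = q ^ (2 * totalWeight w n) * coeff₂ n w x := by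
  induction n with
  | zero => simp [powRep_zero, counit_uq, totalWeight]
  | succ n ih =>
    rw [coeff₂_succ, component_K', map_smul, ih, coeff₂_succ, totalWeight_succ, mul_add,
      zpow_add₀ q_ne_zero, smul_eq_mul]
    ring

theorem coeff₂_Kinv (n : ℕ) (w : ℕ → Fin 3) (x : V2Pow n) :
    coeff₂ n w (powRep n (uq .Kinv) x) = q ^ (-(2 * totalWeight w n)) * coeff₂ n w x := by
  have h := coeff₂_K n w (powRep n (uq .Kinv) x)
  rw [← Module.End.mul_apply, ← map_mul, uq_K_Kinv, map_one, Module.End.one_apply] at h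
  rw [h, zpow_neg, inv_mul_cancel_left₀ (zpow_ne_zero _ q_ne_zero)]

theorem coeff₂_E (n : ℕ) (w : ℕ → Fin 3) (x : V2Pow n) :
    coeff₂ n w (powRep n (uq .E) x) = actE₂ n (fun w' => coeff₂ n w' x) w := by
  induction n with
  | zero => simp [powRep_zero, counit_uq, actE₂]
  | succ n ih =>
    rw [coeff₂_succ, component_E, map_add, ih, actE₂, actE₂, Finset.sum_range_succ]
    congr 1
    · refine Finset.sum_congr rfl fun i hi => ?_
      congr 1
      refine Finset.sum_congr rfl fun b _ => ?_
      rw [coeff₂_succ, Function.update_of_ne (Finset.mem_range.1 hi).ne']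
    · rw [map_sum, Finset.mul_sum]
      refine Finset.sum_congr rfl fun b _ => ?_
      have h : coeff₂ n (Function.update w n b) = coeff₂ n w :=
        coeff₂_congr fun i hi => by rw [Function.update_of_ne hi.ne]
      rw [map_smul, coeff₂_Kinv, coeff₂_succ n (Function.update w n b), Function.update_self, h,
        smul_eq_mul]
      ring

theorem boxSum_weight (n : ℕ) (X : (ℕ → Fin 2) → Cq) (w : ℕ → Fin 3) :
    boxSum n (fun s => q ^ (-height s (2 * n)) * X s) w =
      q ^ (-(2 * totalWeight w n)) * boxSum n X w := by
  rw [← boxSum_mul_left]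
  refine Finset.sum_congr rfl fun s _ => ?_
  beta_reduce
  by_cases h : boxWeight n (extend s) w = 0
  · simp [h]
  · rw [height_two_mul (boxWeight_ne_zero_iff.1 h) n le_rfl]

/-- This is the intertwining property of `π₂` for `E` on a single box, where `q^{∓1}` is the action
of `K⁻¹` on the left strand. -/
theorem boxVec_E (a : Fin 3) (B : Fin 2 → Fin 2 → Cq) :
    ∑ b, V2mat .E a b * ∑ c, ∑ d, boxVec c d b * B c d =
      ∑ c, ∑ d, boxVec c d a * ((if c = 0 then B 1 d else 0) +
        if d = 0 then q ^ (-(if c = 0 then 1 else -1) : ℤ) * B c 1 else 0) := by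
  have := qTwo_ne_zero
  have := q_ne_zero
  have h : q * qTwo = q ^ 2 + 1 := by rw [qTwo_eq]; field_simp
  fin_cases a <;> simp [V2mat, boxVec, Fin.sum_univ_three] <;> field_simp
  · ring
  · linear_combination B 1 1 * h

theorem height_congr {s t : ℕ → Fin 2} {k : ℕ} (h : ∀ i < k, s i = t i) :
    height s k = height t k :=
  Finset.sum_congr rfl fun i hi => by rw [h i (Finset.mem_range.1 hi)]

theorem actE₁_setPair (m : ℕ) (X : (ℕ → Fin 2) → Cq) (c d : Fin 2) (s : ℕ → Fin 2) :
    actE₁ (m + 2) X (setPair m c d s) = actE₁ m (fun s => X (setPair m c d s)) s +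
      q ^ (-height s m) * ((if c = 0 then X (setPair m 1 d s) else 0) +
        if d = 0 then q ^ (-(if c = 0 then 1 else -1) : ℤ) * X (setPair m c 1 s) else 0) := by
  have hm : height (setPair m c d s) m = height s m :=
    height_congr fun i hi => setPair_of_lt hi c d s
  have h1 : Function.update (setPair m c d s) m 1 = setPair m 1 d s := by
    rw [setPair, Function.update_comm (by omega), Function.update_idem]
    rfl
  have h2 : Function.update (setPair m c d s) (m + 1) 1 = setPair m c 1 s := by
    rw [setPair, Function.update_idem]
    rfl
  rw [actE₁, Finset.sum_range_succ, Finset.sum_range_succ, add_assoc, setPair_left, setPair_right,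
    height_succ, setPair_left, hm, h1, h2]
  congr 1
  · refine Finset.sum_congr rfl fun i hi => ?_
    have hi := Finset.mem_range.1 hi
    have h3 : Function.update (setPair m c d s) i 1 = setPair m c d (Function.update s i 1) := by
      rw [setPair, setPair, Function.update_comm (by omega), Function.update_comm (by omega : m ≠ i)]
    rw [setPair_of_lt hi, h3, height_congr fun j hj => setPair_of_lt (hj.trans hi) c d s]
  · rw [neg_add, zpow_add₀ q_ne_zero]
    split_ifs <;> ring

/-- Equivariance of `π₂^{⊗n}` for `E`: the last box is handled by `boxVec_E`, and the factor `K⁻¹`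
in front of it by `boxSum_weight`. -/
theorem actE₂_boxSum (n : ℕ) (X : (ℕ → Fin 2) → Cq) (w : ℕ → Fin 3) :
    actE₂ n (boxSum n X) w = boxSum n (actE₁ (2 * n) X) w := by
  induction n generalizing X with
  | zero => simp [actE₂, actE₁, boxSum, wordSum]
  | succ n ih =>
    let Y : Fin 2 → Fin 2 → (ℕ → Fin 2) → Cq := fun c d s => X (setPair (2 * n) c d s)
    let B : Fin 2 → Fin 2 → Cq := fun c d => boxSum n (Y c d) w
    have h1 : ∑ i ∈ Finset.range n, q ^ (-(2 * totalWeight w i)) *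
        ∑ b, V2mat .E (w i) b * boxSum (n + 1) X (Function.update w i b) =
        ∑ c, ∑ d, boxVec c d (w n) * boxSum n (actE₁ (2 * n) (Y c d)) w := by
      simp only [← ih, actE₂, Fin.sum_univ_two, Finset.mul_sum, ← Finset.sum_add_distrib]
      refine Finset.sum_congr rfl fun i hi => ?_
      simp only [boxSum_succ, Function.update_of_ne (Finset.mem_range.1 hi).ne', Fin.sum_univ_two,
        Fin.sum_univ_three]
      ring
    have h2 : ∀ b, boxSum (n + 1) X (Function.update w n b) =
        ∑ c, ∑ d, boxVec c d b * B c d := by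
      intro b
      rw [boxSum_succ, Function.update_self]
      refine Finset.sum_congr rfl fun c _ => Finset.sum_congr rfl fun d _ => ?_
      rw [boxSum_congr fun i (hi : i < n) => Function.update_of_ne hi.ne b w]
    have h3 : ∀ c d, boxSum n (fun s => actE₁ (2 * (n + 1)) X (setPair (2 * n) c d s)) w =
        boxSum n (actE₁ (2 * n) (Y c d)) w + q ^ (-(2 * totalWeight w n)) *
          ((if c = 0 then B 1 d else 0) +
            if d = 0 then q ^ (-(if c = 0 then 1 else -1) : ℤ) * B c 1 else 0) := by
      intro c d
      simp only [mul_add 2 n 1, mul_one, actE₁_setPair]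
      rw [boxSum_add, boxSum_weight, boxSum_add]
      congr 3
      · split_ifs with h
        · rfl
        · simpa using boxSum_mul_left n 0 (fun _ => 0) w
      · split_ifs with h
        · exact boxSum_mul_left _ _ _ _
        · exact boxSum_mul_left _ _ _ _
        · simpa using boxSum_mul_left n 0 (fun _ => 0) w
    rw [actE₂, Finset.sum_range_succ, h1, boxSum_succ]
    simp only [h2, h3]
    rw [boxVec_E]
    simp only [Fin.sum_univ_two]
    ring

theorem skip_injective (l : ℕ) : Function.Injective (skip l) := by
  intro a b h
  simp only [skip] at h
  split_ifs at h <;> omega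

/-- The vector `δ₁(1)` is invariant: the contributions of `E` at its two strands cancel (`hcup`),
and its weight 0 leaves the powers of `q` for strands to the right unchanged. -/
theorem actE₁_cup {l m : ℕ} (hl : l ≤ m) (X : (ℕ → Fin 2) → Cq) (s : ℕ → Fin 2) :
    actE₁ (m + 2) (fun s => eps (s l) (s (l + 1)) * X (s ∘ skip l)) s =
      eps (s l) (s (l + 1)) * actE₁ m X (s ∘ skip l) := by
  obtain ⟨p, rfl⟩ := Nat.exists_eq_add_of_le hl
  have hcup : (if s l = 0 then q ^ (-height s l) * eps 1 (s (l + 1)) else 0) +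
      (if s (l + 1) = 0 then q ^ (-height s (l + 1)) * eps (s l) 1 else 0) = 0 := by
    rw [height_succ, neg_add, zpow_add₀ q_ne_zero]
    generalize s l = a
    generalize s (l + 1) = b
    fin_cases a <;> fin_cases b <;> simp [eps]
  have hupd : ∀ i, Function.update s (skip l i) 1 ∘ skip l = Function.update (s ∘ skip l) i 1 :=
    fun i => Function.update_comp_eq_of_injective _ (skip_injective l) _ _
  have hl1 : Function.update s l 1 ∘ skip l = s ∘ skip l := by
    funext t
    rw [Function.comp_apply, Function.update_of_ne]
    · rfl
    · simp only [skip]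
      split_ifs <;> omega
  have hl2 : Function.update s (l + 1) 1 ∘ skip l = s ∘ skip l := by
    funext t
    rw [Function.comp_apply, Function.update_of_ne]
    · rfl
    · simp only [skip]
      split_ifs <;> omega
  have hlow : ∀ i < l, skip l i = i := fun i hi => by simp [skip, hi]
  have hhigh : ∀ i, skip l (l + i) = l + 2 + i := fun i => by simp [skip]; omega
  rw [actE₁, actE₁, show l + p + 2 = l + 2 + p by ring, Finset.sum_range_add _ (l + 2) p,
    Finset.sum_range_add _ l p, Finset.sum_range_succ, Finset.sum_range_succ, mul_add, Finset.mul_sum, Finset.mul_sum]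
  have hmid : ∀ A B C D : Cq, B + C = 0 → A + B + C + D = A + D := by
    intro A B C D h
    linear_combination h
  rw [hmid]
  · congr 1
    · refine Finset.sum_congr rfl fun i hi => ?_
      have hi := Finset.mem_range.1 hi
      have h := hupd i
      rw [hlow i hi] at h
      rw [Function.comp_apply, hlow i hi, h, Function.update_of_ne (by omega),
        Function.update_of_ne (by omega), height_skip_of_le _ hi.le]
      split_ifs <;> ring
    · refine Finset.sum_congr rfl fun i hi => ?_
      have h := hupd (l + i)
      rw [hhigh i] at h
      rw [Function.comp_apply, hhigh, h, Function.update_of_ne (by omega),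
        Function.update_of_ne (by omega)]
      by_cases he : eps (s l) (s (l + 1)) = 0
      · simp [he]
      · rw [height_skip_of_ge (eps_ne_zero he) (by omega), show l + i + 2 = l + 2 + i by ring]
        split_ifs <;> ring
  · rw [hl1, hl2, Function.update_self, Function.update_self, Function.update_of_ne (by omega),
      Function.update_of_ne (by omega)]
    have : ∀ (p p' : Prop) [Decidable p] [Decidable p'] (A B C D Z : Cq),
        ((if p then A * B else 0) + if p' then C * D else 0) = 0 →
        ((if p then A * (B * Z) else 0) + if p' then C * (D * Z) else 0) = 0 := by
      intro p p' _ _ A B C D Z h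
      have h' : ((if p then A * (B * Z) else 0) + if p' then C * (D * Z) else 0) =
          ((if p then A * B else 0) + if p' then C * D else 0) * Z := by
        split_ifs <;> ring
      rw [h', h, zero_mul]
    exact this _ _ _ _ _ _ _ hcup

theorem actE₁_diag {n : ℕ} {r : Setoid (Fin n)} (hr : NonCrossing r) :
    ∀ s, actE₁ (2 * n) (diag r) s = 0 := by
  induction hr using NonCrossing.induction with
  | zero r hr => exact fun s => rfl
  | insert m j r hr ih =>
    intro s
    rw [funext (diag_insertPoint j r)]
    exact (actE₁_cup (m := 2 * m) (by omega) _ s).trans (by rw [ih, mul_zero])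
  | double m j r hr ih =>
    intro s
    rw [funext (diag_doublePoint j r)]
    exact (actE₁_cup (m := 2 * m) (by omega) _ s).trans (by rw [ih, mul_zero])

/-- Only `E` and `K` have to be checked. `E` annihilates the diagram before the boxes are applied,
and `K` fixes the image because a nonzero coefficient has as many up as down steps. -/
theorem boxes_mem_Inv {n : ℕ} {r : Setoid (Fin n)} (hr : NonCrossing r) {x : V1Pow (2 * n)}
    (hx : ∀ s, coeff₁ (2 * n) s x = diag r s) : boxes n x ∈ Inv n := by
  have hb : ∀ w, coeff₂ n w (boxes n x) = boxSum n (diag r) w := by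
    intro w
    rw [coeff₂_boxes, funext hx]
  refine mem_Inv_iff.2 ⟨ext_coeff₂ fun w => ?_, ext_coeff₂ fun w => ?_⟩
  · rw [coeff₂_E, map_zero, funext hb, actE₂_boxSum, funext (actE₁_diag hr)]
    exact Finset.sum_eq_zero fun s _ => mul_zero _
  · rw [coeff₂_K, hb, ← boxSum_mul_left]
    refine Finset.sum_congr rfl fun s _ => ?_
    beta_reduce
    by_cases h : boxWeight n (extend s) w = 0
    · simp [h]
    · by_cases h' : diag r (extend s) = 0
      · simp [h']
      · rw [← height_two_mul (boxWeight_ne_zero_iff.1 h) n le_rfl,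
          height_eq_zero_of_diag_ne_zero hr _ h', zpow_zero, one_mul]

/-! ### Diagrams with singletons, and leading coefficients -/

/-- Both terms of `π₂(δ₁(1))` are multiples of `v⁰`, with opposite coefficients `q⁻¹` and `-q⁻¹`.
Boxes to the right of the arc are peeled off first. -/
theorem boxSum_cup {n j : ℕ} (hj : j < n) (X : (ℕ → Fin 2) → Cq) (w : ℕ → Fin 3) :
    boxSum n (fun s => eps (s (2 * j)) (s (2 * j + 1)) * X (s ∘ skip (2 * j))) w = 0 := by
  induction n generalizing X with
  | zero => omega
  | succ n ih =>
    rw [boxSum_succ]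
    rcases Nat.lt_succ_iff_lt_or_eq.1 hj with h | rfl
    · refine Finset.sum_eq_zero fun c _ => Finset.sum_eq_zero fun d _ => ?_
      convert mul_zero _
      -- After the arc at box `j` is deleted, the fixed letters of the last box, formerly box `n`,
      -- sit at box `n - 1`.
      convert ih h fun s => X (setPair (2 * (n - 1)) c d s) using 2
      funext s
      rw [setPair_of_lt (by omega), setPair_of_lt (by omega)]
      congr 2
      rw [setPair, setPair, ← Function.update_comp_eq_of_injective _ (skip_injective _),
        ← Function.update_comp_eq_of_injective _ (skip_injective _)]
      have h1 : skip (2 * j) (2 * (n - 1)) = 2 * n := by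
        simp only [skip]
        split_ifs <;> omega
      have h2 : skip (2 * j) (2 * (n - 1) + 1) = 2 * n + 1 := by
        simp only [skip]
        split_ifs <;> omega
      rw [h1, h2]
    · have h1 : ∀ c d s, setPair (2 * j) c d s ∘ skip (2 * j) = s ∘ skip (2 * j) := by
        intro c d s
        funext t
        simp only [Function.comp_apply, setPair, skip]
        split_ifs <;> rw [Function.update_of_ne (by omega), Function.update_of_ne (by omega)]
      simp only [setPair_left, setPair_right, h1, boxSum_mul_left]
      have := q_ne_zero
      generalize w j = a
      fin_cases a <;> simp [boxVec, eps]
      ring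

theorem boxes_eq_zero {n : ℕ} {r : Setoid (Fin n)} {j : Fin n} (hj : ∀ k, r j k → k = j)
    {x : V1Pow (2 * n)} (hx : ∀ s, coeff₁ (2 * n) s x = diag r s) : boxes n x = 0 := by
  obtain ⟨m, rfl⟩ : ∃ m, n = m + 1 := ⟨n - 1, by have := j.2; omega⟩
  refine ext_coeff₂ fun w => ?_
  rw [coeff₂_boxes, map_zero, funext hx, ← insertPoint_comap hj, funext (diag_insertPoint _ _)]
  exact boxSum_cup j.2 _ w

/-- The image in `V₂^{⊗n}` of a word for `V₁^{⊗2n}`. -/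
def wordOf (u : ℕ → Fin 2) (i : ℕ) : Fin 3 := letter (u (2 * i)) (u (2 * i + 1))

/-- Even heights agree. At odd places the only freedom is up-down against down-up in a box of weight
0, and `u` always makes the lower choice. -/
theorem height_le_of_wordOf {n : ℕ} {s u : ℕ → Fin 2}
    (hu : ∀ i < n, ¬ (u (2 * i) = 0 ∧ u (2 * i + 1) = 1)) (h : boxWeight n s (wordOf u) ≠ 0) :
    ∀ k ≤ 2 * n, height u k ≤ height s k := by
  have h1 := height_two_mul (boxWeight_ne_zero_iff.1 h)
  have h2 := height_two_mul (n := n) (s := u) (w := wordOf u) fun _ _ => rfl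
  intro k hk
  obtain ⟨i, rfl | rfl⟩ : ∃ i, k = 2 * i ∨ k = 2 * i + 1 := ⟨k / 2, by omega⟩
  · rw [h1 i (by omega), h2 i (by omega)]
  · rw [height_succ, height_succ, h1 i (by omega), h2 i (by omega)]
    have h3 := boxWeight_ne_zero_iff.1 h i (by omega)
    have h4 := hu i (by omega)
    rw [wordOf] at h3
    revert h3 h4
    generalize s (2 * i) = a
    generalize s (2 * i + 1) = b
    generalize u (2 * i) = c
    generalize u (2 * i + 1) = d
    fin_cases a <;> fin_cases b <;> fin_cases c <;> fin_cases d <;> simp [letter]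

/-- Some word `s` contributes; it lies above `u'` because it has the same image, and below `u`
because it occurs in the diagram. -/
theorem height_le_of_coeff₂_ne_zero {n : ℕ} {r : Setoid (Fin n)} (hr : NonCrossing r)
    {x : V1Pow (2 * n)} (hx : ∀ s, coeff₁ (2 * n) s x = diag r s) {u u' : ℕ → Fin 2}
    (hu : IsLead r u) (hu' : ∀ i < n, ¬ (u' (2 * i) = 0 ∧ u' (2 * i + 1) = 1))
    (h : coeff₂ n (wordOf u') (boxes n x) ≠ 0) :
    ∀ k ≤ 2 * n, height u' k ≤ height u k := by
  rw [coeff₂_boxes, funext hx] at h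
  obtain ⟨s, -, hs⟩ := Finset.exists_ne_zero_of_sum_ne_zero h
  exact fun k hk => (height_le_of_wordOf hu' (left_ne_zero_of_mul hs) k hk).trans
    (height_le_of_diag_ne_zero hr _ u (right_ne_zero_of_mul hs) hu k hk)

/-- The same two bounds with one word `u` on both sides leave only the term of `u` itself, so
nothing can cancel it. -/
theorem coeff₂_boxes_ne_zero {n : ℕ} {r : Setoid (Fin n)} (hr : NonCrossing r)
    {x : V1Pow (2 * n)} (hx : ∀ s, coeff₁ (2 * n) s x = diag r s) {u : ℕ → Fin 2}
    (hu : IsLead r u) (hu' : ∀ i < n, ¬ (u (2 * i) = 0 ∧ u (2 * i + 1) = 1)) :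
    coeff₂ n (wordOf u) (boxes n x) ≠ 0 := by
  rw [coeff₂_boxes, funext hx, boxSum, wordSum,
    Finset.sum_eq_single fun i : Fin (2 * n) => u i]
  · have h : ∀ i < 2 * n, u i = extend (fun i : Fin (2 * n) => u i) i := by
      intro i hi
      simp [extend, hi]
    refine mul_ne_zero (boxWeight_ne_zero_iff.2 fun i hi => ?_) ?_
    · rw [← h _ (by omega), ← h _ (by omega), wordOf]
    · rw [diag_isLead hr _ (hu.congr h)]
      exact one_ne_zero
  · intro s _ hs
    by_contra hne
    refine hs (funext fun i => ?_)
    have := eq_of_height_eq (s := extend s) (u := u) (N := 2 * n) (fun k hk => le_antisymm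
      (height_le_of_diag_ne_zero hr _ u (right_ne_zero_of_mul hne) hu k hk)
      (height_le_of_wordOf hu' (left_ne_zero_of_mul hne) k hk)) i i.2
    rw [← this, extend_apply]
  · exact fun h => absurd (Finset.mem_univ _) h

instance finiteSetoid (n : ℕ) : Finite (Setoid (Fin n)) :=
  Finite.of_injective (fun r : Setoid (Fin n) => fun a b => r a b) fun _ _ h =>
    Setoid.ext fun a b => iff_of_eq (congrFun (congrFun h a) b)

instance fintypeSetoid (n : ℕ) : Fintype (Setoid (Fin n)) := Fintype.ofFinite _

/-! ### The vector of a partition diagram -/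

/-- The vector of `V₁^{⊗2n}` whose coefficients are given by `diag r`. -/
def diagram {n : ℕ} (r : Setoid (Fin n)) : V1Pow (2 * n) :=
  ∑ t : Fin (2 * n) → Fin 2, diag r (extend t) • V1basis (2 * n) t

theorem coeff₁_sum_basis (m : ℕ) (g : (Fin m → Fin 2) → Cq) (s : ℕ → Fin 2) :
    coeff₁ m s (∑ t, g t • V1basis m t) = g fun i => s i := by
  simp [coeff₁_basis]

theorem coeff₁_diagram {n : ℕ} (r : Setoid (Fin n)) (s : ℕ → Fin 2) :
    coeff₁ (2 * n) s (diagram r) = diag r s := by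
  rw [diagram, coeff₁_sum_basis]
  exact diag_congr r fun i hi => by simp [extend, hi]

theorem eq_diagram {n : ℕ} {r : Setoid (Fin n)} {x : V1Pow (2 * n)}
    (h : ∀ s, coeff₁ (2 * n) s x = diag r s) : x = diagram r :=
  ext_coeff₁ fun s => by rw [h, coeff₁_diagram]

/-! ### Diagrams of linear trees -/

/-- The vector `x` is the diagram of the linear tree with `k` leaves plus a combination of diagrams
of other noncrossing partitions. -/
def IsUnitriangular (k : ℕ) (x : V1Pow (2 * k)) : Prop :=
  ∃ a : Setoid (Fin k) → Cq, x = ∑ r, a r • diagram r ∧ a ⊤ = 1 ∧ ∀ r, a r ≠ 0 → NonCrossing r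

theorem nonCrossing_top (n : ℕ) : NonCrossing (⊤ : Setoid (Fin n)) :=
  fun _ _ _ _ _ _ _ _ _ => trivial

theorem isUnitriangular_diagram_top (k : ℕ) : IsUnitriangular k (diagram ⊤) := by
  classical
  refine ⟨fun r => if r = ⊤ then 1 else 0, by simp, by simp, fun r hr => ?_⟩
  obtain rfl : r = ⊤ := by
    by_contra h
    simp [h] at hr
  exact nonCrossing_top k

theorem cup_diagram_double {k : ℕ} (j : Fin k) (r : Setoid (Fin k)) :
    cup (2 * k) ⟨2 * j + 1, by omega⟩ (diagram r) = diagram (doublePoint j r) := by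
  refine eq_diagram (n := k + 1) fun s => ?_
  rw [diag_doublePoint, ← coeff₁_diagram]
  exact coeff₁_cup _ _ _ _

theorem cup_diagram_insert {k : ℕ} (j : Fin (k + 1)) (r : Setoid (Fin k)) :
    cup (2 * k) ⟨2 * j, by omega⟩ (diagram r) = diagram (insertPoint j r) := by
  refine eq_diagram (n := k + 1) fun s => ?_
  rw [diag_insertPoint, ← coeff₁_diagram]
  exact coeff₁_cup _ _ _ _

theorem doublePoint_eq_top_iff {k : ℕ} (j : Fin k) (r : Setoid (Fin k)) :
    doublePoint j r = ⊤ ↔ r = ⊤ :=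
  ⟨fun h => Setoid.comap_injective _ (predAbove_surjective j) h, fun h => h ▸ rfl⟩

theorem insertPoint_ne_top {k : ℕ} (i : Fin (k + 1)) (j : Fin k) (r : Setoid (Fin k)) :
    insertPoint i r ≠ ⊤ := fun h =>
  insertPoint_succAbove_self i r j (by rw [h]; trivial)

/-- Doubling sends only `⊤` to `⊤`, and insertion never produces `⊤`, so the leading coefficient
remains 1. The new coefficients are sums over the fibres of these two maps. -/
theorem IsUnitriangular.cup_add {k : ℕ} {x : V1Pow (2 * k)} (hx : IsUnitriangular k x)
    (j : Fin k) (i : Fin (k + 1)) (c : Cq) :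
    IsUnitriangular (k + 1) (cup (2 * k) ⟨2 * j + 1, by omega⟩ x +
      c • cup (2 * k) ⟨2 * i, by omega⟩ x) := by
  classical
  obtain ⟨a, rfl, h1, ha⟩ := hx
  refine ⟨fun r' => (∑ r with doublePoint j r = r', a r) +
    c * ∑ r with insertPoint i r = r', a r, ?_, ?_, fun r' hr' => ?_⟩
  · have h : ∀ g : Setoid (Fin k) → Setoid (Fin (k + 1)),
        ∑ r', (∑ r with g r = r', a r) • diagram r' = ∑ r, a r • diagram (g r) := by
      intro g
      rw [← Finset.sum_fiberwise Finset.univ g fun r => a r • diagram (g r)]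
      refine Finset.sum_congr rfl fun r' _ => ?_
      rw [Finset.sum_smul]
      refine Finset.sum_congr rfl fun r hr => ?_
      rw [(Finset.mem_filter.1 hr).2]
    simp only [add_smul, mul_smul, Finset.sum_add_distrib, ← Finset.smul_sum, h, map_sum, map_smul]
    congr 1
    · exact Finset.sum_congr rfl fun r _ => congrArg _ (cup_diagram_double j r)
    · exact congrArg _ (Finset.sum_congr rfl fun r _ => congrArg _ (cup_diagram_insert i r))
  · have h2 : (Finset.univ.filter fun r : Setoid (Fin k) => doublePoint j r = ⊤) = {⊤} := by
      ext r
      simp [doublePoint_eq_top_iff]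
    have h3 : (Finset.univ.filter fun r : Setoid (Fin k) => insertPoint i r = ⊤) = ∅ := by
      ext r
      simp [insertPoint_ne_top i j]
    beta_reduce
    rw [h2, h3, Finset.sum_singleton, h1, Finset.sum_empty, mul_zero, add_zero]
  · beta_reduce at hr'
    by_cases h : (∑ r with doublePoint j r = r', a r) = 0
    · rw [h, zero_add] at hr'
      obtain ⟨r, hr, har⟩ := Finset.exists_ne_zero_of_sum_ne_zero (right_ne_zero_of_mul hr')
      exact (Finset.mem_filter.1 hr).2 ▸ (ha r har).insertPoint i
    · obtain ⟨r, hr, har⟩ := Finset.exists_ne_zero_of_sum_ne_zero h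
      exact (Finset.mem_filter.1 hr).2 ▸ (ha r har).doublePoint j

instance subsingletonSetoidZero : Subsingleton (Setoid (Fin 0)) :=
  ⟨fun _ _ => Setoid.ext fun a _ => a.elim0⟩

instance subsingletonSetoidOne : Subsingleton (Setoid (Fin 1)) :=
  ⟨fun r r' => Setoid.ext fun a b => by
    rw [Subsingleton.elim a b]
    exact iff_of_true (r.refl' b) (r'.refl' b)⟩

theorem emptyDiagram_eq : emptyDiagram = diagram (⊤ : Setoid (Fin 0)) :=
  eq_diagram (n := 0) fun s => (coeff₁_emptyDiagram s).trans (diag_zero _ _).symm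

/-- Truncated subtraction makes the first place 0, so the first arc creates a single box rather than
doubling one. -/
theorem cup_emptyDiagram : cup (2 * 0) ⟨2 * 0 - 1, by omega⟩ emptyDiagram =
    diagram (⊤ : Setoid (Fin 1)) := by
  rw [emptyDiagram_eq, Subsingleton.elim (⊤ : Setoid (Fin 1)) (insertPoint 0 ⊤)]
  exact cup_diagram_insert 0 ⊤

theorem linTree₀_eq (k : ℕ) : linTree₀ k = diagram ⊤ := by
  induction k with
  | zero => exact emptyDiagram_eq
  | succ k ih =>
    rcases k with _ | k
    · exact cup_emptyDiagram
    · rw [linTree₀, ih]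
      exact (cup_diagram_double (Fin.last k) ⊤).trans (congrArg diagram
        ((doublePoint_eq_top_iff _ _).2 rfl))

/-- The linear tree, with a projector on its last edge if this edge becomes internal when it is
split. -/
def linTreeSplit (k : ℕ) : V1Pow (2 * k) :=
  if h : 3 ≤ k then
    jwAt (⟨2 * k - 2, by omega⟩ : Fin (2 * k)) ⟨2 * k - 1, by omega⟩ (linTree k)
  else linTree k

theorem linTree_succ (k : ℕ) :
    linTree (k + 1) = cup (2 * k) ⟨2 * k - 1, by omega⟩ (linTreeSplit k) := rfl

/-- The two claims feed each other: a new leaf doubles the last point of the split tree, and the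
projector needed for the next leaf sits beside the arc just created. -/
theorem isUnitriangular_linTreeSplit (k : ℕ) :
    IsUnitriangular k (linTree k) ∧ IsUnitriangular k (linTreeSplit k) := by
  induction k with
  | zero =>
    have h : IsUnitriangular 0 (linTree 0) := by
      rw [show linTree 0 = diagram ⊤ from emptyDiagram_eq]
      exact isUnitriangular_diagram_top 0
    exact ⟨h, h⟩
  | succ k ih =>
    rcases k with _ | k
    · have h : IsUnitriangular 1 (linTree 1) := by
        rw [show linTree 1 = diagram ⊤ from cup_emptyDiagram]
        exact isUnitriangular_diagram_top 1
      exact ⟨h, h⟩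
    · have h : IsUnitriangular (k + 2) (linTree (k + 2)) := by
        have := ih.2.cup_add (Fin.last k) 0 0
        rw [zero_smul, add_zero] at this
        exact this
      refine ⟨h, ?_⟩
      rw [linTreeSplit]
      split_ifs with h3
      · have := ih.2.cup_add (Fin.last k) (Fin.last (k + 1)) qTwo⁻¹
        -- The shifted arc from the skein relation lies at an even place, the last box, and so
        -- inserts a singleton there.
        have h4 := jwAt_cup (k := 2 * (k + 1)) (l := 2 * k + 1) (by omega) (linTreeSplit (k + 1))
        rw [linTree_succ]
        exact h4.symm ▸ this
      · exact h

/-! ### Partitions refining a given one -/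

section Glue

variable {n : ℕ} (P : Finpartition (Finset.univ : Finset (Fin n)))

/-- The increasing enumeration of a part. -/
def enum (B : P.parts) : Fin B.1.card ↪o Fin n := B.1.orderEmbOfFin rfl

theorem exists_enum (a : Fin n) : ∃ B x, enum P B x = a := by
  have ha : a ∈ P.part a := P.mem_part (Finset.mem_univ a)
  refine ⟨⟨P.part a, P.part_mem.2 (Finset.mem_univ a)⟩, ?_⟩
  have := Finset.range_orderEmbOfFin (P.part a) rfl
  rw [← Finset.mem_coe, ← this] at ha
  exact ha

theorem enum_mem (B : P.parts) (x : Fin B.1.card) : enum P B x ∈ B.1 :=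
  Finset.orderEmbOfFin_mem _ _ _

theorem part_enum (B : P.parts) (x : Fin B.1.card) : P.part (enum P B x) = B :=
  P.part_eq_of_mem B.2 (enum_mem P B x)

theorem enum_eq {B B' : P.parts} {x : Fin B.1.card} {x' : Fin B'.1.card}
    (h : enum P B x = enum P B' x') : B = B' :=
  Subtype.ext (by rw [← part_enum P B x, h, part_enum])

/-- The partition obtained by partitioning each part of `P`. -/
def glue (p : ∀ B : P.parts, Setoid (Fin B.1.card)) : Setoid (Fin n) where
  r a b := ∃ B x y, enum P B x = a ∧ enum P B y = b ∧ p B x y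
  iseqv := by
    refine ⟨fun a => ?_, ?_, ?_⟩
    · obtain ⟨B, x, rfl⟩ := exists_enum P a
      exact ⟨B, x, x, rfl, rfl, (p B).refl' x⟩
    · rintro a b ⟨B, x, y, rfl, rfl, h⟩
      exact ⟨B, y, x, rfl, rfl, (p B).symm' h⟩
    · rintro a b c ⟨B, x, y, rfl, rfl, h⟩ ⟨B', x', y', h1, rfl, h'⟩
      obtain rfl := enum_eq P h1
      obtain rfl := (enum P B').injective h1
      exact ⟨_, x, y', rfl, rfl, (p _).trans' h h'⟩

variable {P}

theorem glue_enum_left {p : ∀ B : P.parts, Setoid (Fin B.1.card)} {B : P.parts}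
    {x : Fin B.1.card} {b : Fin n} :
    glue P p (enum P B x) b ↔ ∃ y, enum P B y = b ∧ p B x y := by
  constructor
  · rintro ⟨B', x', y', h1, rfl, h⟩
    obtain rfl := enum_eq P h1
    obtain rfl := (enum P B').injective h1
    exact ⟨y', rfl, h⟩
  · rintro ⟨y, rfl, h⟩
    exact ⟨B, x, y, rfl, rfl, h⟩

theorem glue_enum {p : ∀ B : P.parts, Setoid (Fin B.1.card)} {B : P.parts}
    {x y : Fin B.1.card} : glue P p (enum P B x) (enum P B y) ↔ p B x y := by
  rw [glue_enum_left]
  constructor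
  · rintro ⟨y', h1, h⟩
    obtain rfl := (enum P B).injective h1
    exact h
  · exact fun h => ⟨y, rfl, h⟩

theorem glue_le (p : ∀ B : P.parts, Setoid (Fin B.1.card)) : glue P p ≤ Setoid.ker P.part := by
  rintro a b ⟨B, x, y, rfl, rfl, _⟩
  rw [Setoid.ker_def, part_enum, part_enum]

theorem glue_top : glue P (fun _ => ⊤) = Setoid.ker P.part := by
  refine le_antisymm (glue_le _) fun a b h => ?_
  obtain ⟨B, x, rfl⟩ := exists_enum P a
  obtain ⟨B', y, rfl⟩ := exists_enum P b
  rw [Setoid.ker_def, part_enum, part_enum] at h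
  obtain rfl := Subtype.ext h
  exact glue_enum.2 trivial

/-- Only the trivial choice in every part gives back the original partition; this makes the
correction terms strictly finer. -/
theorem eq_top_of_glue {p : ∀ B : P.parts, Setoid (Fin B.1.card)}
    (h : glue P p = Setoid.ker P.part) : p = fun _ => ⊤ := by
  funext B
  refine Setoid.ext fun x y => iff_of_true (glue_enum.1 ?_) trivial
  rw [h, Setoid.ker_def, part_enum, part_enum]

/-- The restriction of a word to the strands at the boxes in `B`. -/
def partWord (B : Finset (Fin n)) (s : ℕ → Fin 2) : ℕ → Fin 2 :=
  extend fun j : Fin (2 * B.card) => s (strandOf B j)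

theorem partWord_two_mul (B : P.parts) (s : ℕ → Fin 2) (x : Fin B.1.card) :
    partWord B.1 s (2 * x) = s (2 * enum P B x) := by
  have hx : 2 * (x : ℕ) < 2 * B.1.card := by have := x.2; omega
  have h : (⟨2 * (x : ℕ) / 2, by omega⟩ : Fin B.1.card) = x := Fin.ext (by simp)
  simp only [partWord, extend, dif_pos hx, strandOf, h, enum]
  congr 1
  omega

theorem partWord_two_mul_add_one (B : P.parts) (s : ℕ → Fin 2) (x : Fin B.1.card) :
    partWord B.1 s (2 * x + 1) = s (2 * enum P B x + 1) := by
  have hx : 2 * (x : ℕ) + 1 < 2 * B.1.card := by have := x.2; omega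
  have h : (⟨(2 * (x : ℕ) + 1) / 2, by omega⟩ : Fin B.1.card) = x := Fin.ext (by simp; omega)
  simp only [partWord, extend, dif_pos hx, strandOf, h, enum]
  congr 1
  omega

/-- Arcs never leave a part, and the enumeration of a part preserves order, hence also successors
and first elements. -/
theorem diag_glue (p : ∀ B : P.parts, Setoid (Fin B.1.card)) (s : ℕ → Fin 2) :
    diag (glue P p) s = ∏ B, diag (p B) (partWord B.1 s) := by
  have hbij : Function.Bijective fun z : Σ B : P.parts, Fin B.1.card => enum P z.1 z.2 := by
    constructor
    · rintro ⟨B, x⟩ ⟨B', x'⟩ h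
      obtain rfl := enum_eq P h
      exact Sigma.ext rfl (heq_of_eq ((enum P _).injective h))
    · intro a
      obtain ⟨B, x, h⟩ := exists_enum P a
      exact ⟨⟨B, x⟩, h⟩
  simp only [diag]
  rw [← Fintype.prod_sigma', ← hbij.prod_comp]
  refine Finset.prod_congr rfl fun z _ => ?_
  obtain ⟨B, x⟩ := z
  refine arc_transfer (enum P B) (enum P B).monotone (fun k hk => glue_enum.2 hk)
    (fun y hy => ?_) (fun k _ hk => (enum P B).strictMono hk)
    (fun k => (partWord_two_mul B s k).symm) (partWord_two_mul_add_one B s x).symm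
  obtain ⟨y, rfl, h⟩ := glue_enum_left.1 hy
  exact ⟨y, h, le_rfl, fun h => (enum P B).lt_iff_lt.1 h⟩

end Glue

/-! ### Diagrams of Riordan trees -/

/-- The equivalence relation given by the parts of a Riordan tree. -/
def RiordanTree.rel {n : ℕ} (T : RiordanTree n) : Setoid (Fin n) := Setoid.ker T.partition.part

/-- A crossing inside one part is excluded by `hp`, and a crossing between two parts by the tree. -/
theorem nonCrossing_glue {n : ℕ} (T : RiordanTree n)
    {p : ∀ B : T.partition.parts, Setoid (Fin B.1.card)} (hp : ∀ B, NonCrossing (p B)) :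
    NonCrossing (glue T.partition p) := by
  rintro a b c d hab hbc hcd ⟨B, x, z, rfl, rfl, h⟩ ⟨B', y, t, rfl, rfl, h'⟩
  by_cases hB : B = B'
  · subst hB
    rw [(enum T.partition B).lt_iff_lt] at hab hbc hcd
    exact glue_enum.2 (hp B x y z t hab hbc hcd h h')
  · exact absurd ⟨hab, hbc, hcd⟩ (T.nonCrossing B.1 B.2 B'.1 B'.2 (fun h => hB (Subtype.ext h))
      _ (enum_mem _ _ _) _ (enum_mem _ _ _) _ (enum_mem _ _ _) _ (enum_mem _ _ _))

theorem RiordanTree.nonCrossing_rel {n : ℕ} (T : RiordanTree n) : NonCrossing T.rel := by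
  rw [RiordanTree.rel, ← glue_top]
  exact nonCrossing_glue T fun B => nonCrossing_top _

theorem coeff₁_placeOn (D : (k : ℕ) → V1Pow (2 * k)) {n : ℕ} (T : RiordanTree n) (s : ℕ → Fin 2) :
    coeff₁ (2 * n) s (placeOn D T) = ∏ B : T.partition.parts,
      coeff₁ (2 * B.1.card) (partWord B.1 s) (D B.1.card) := by
  rw [placeOn, coeff₁_sum_basis,
    ← Finset.prod_coe_sort T.partition.parts fun B => ((V1basis (2 * B.card)).repr (D B.card))
      fun j => s (strandOf B j)]
  refine Finset.prod_congr rfl fun B _ => ?_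
  simp only [coeff₁, Module.Basis.coord_apply, partWord, extend_apply]

theorem f₀_eq {n : ℕ} (T : RiordanTree n) : f₀ T = boxes n (diagram T.rel) := by
  have h : placeOn linTree₀ T = diagram T.rel := by
    refine eq_diagram fun s => ?_
    rw [coeff₁_placeOn, RiordanTree.rel, ← glue_top, diag_glue]
    exact Finset.prod_congr rfl fun B _ => by rw [linTree₀_eq, coeff₁_diagram]
  rw [f₀, h]

/-- Expand the product over the parts of the expansions of their linear trees: each choice of one
partition per part contributes one glued diagram, with the product of the coefficients. -/
theorem exists_placeOn_linTree {n : ℕ} (T : RiordanTree n) :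
    ∃ c : (∀ B : T.partition.parts, Setoid (Fin B.1.card)) → Cq,
      placeOn linTree T = ∑ p, c p • diagram (glue T.partition p) ∧ c (fun _ => ⊤) = 1 ∧
      ∀ p, c p ≠ 0 → NonCrossing (glue T.partition p) := by
  classical
  choose a h1 h2 h3 using fun k => (isUnitriangular_linTreeSplit k).1
  refine ⟨fun p => ∏ B, a B.1.card (p B), ext_coeff₁ fun s => ?_, ?_, fun p hp => ?_⟩
  · rw [coeff₁_placeOn, map_sum]
    have h4 : ∀ B : T.partition.parts, coeff₁ (2 * B.1.card) (partWord B.1 s) (linTree B.1.card) =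
        ∑ r, a B.1.card r * diag r (partWord B.1 s) := by
      intro B
      rw [h1 B.1.card, map_sum]
      exact Finset.sum_congr rfl fun r _ => by rw [map_smul, coeff₁_diagram, smul_eq_mul]
    rw [Finset.prod_congr rfl fun B _ => h4 B, Finset.prod_univ_sum, Fintype.piFinset_univ]
    refine Finset.sum_congr rfl fun p _ => ?_
    rw [map_smul, coeff₁_diagram, diag_glue, smul_eq_mul, Finset.prod_mul_distrib]
  · exact Finset.prod_eq_one fun B _ => h2 _
  · exact nonCrossing_glue T fun B => h3 _ _ (Finset.prod_ne_zero_iff.1 hp B (Finset.mem_univ B))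

theorem RiordanTree.rel_injective (n : ℕ) :
    Function.Injective (RiordanTree.rel : RiordanTree n → Setoid (Fin n)) := by
  intro T T' h
  have hpart : ∀ a, T.partition.part a = T'.partition.part a := by
    intro a
    ext b
    rw [Finpartition.mem_part_iff_part_eq_part _ (Finset.mem_univ _) (Finset.mem_univ _),
      Finpartition.mem_part_iff_part_eq_part _ (Finset.mem_univ _) (Finset.mem_univ _)]
    exact iff_of_eq (congrArg (fun r : Setoid (Fin n) => r b a) h)
  have hparts : ∀ P : Finpartition (Finset.univ : Finset (Fin n)), ∀ B,
      B ∈ P.parts ↔ ∃ a, P.part a = B := by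
    intro P B
    constructor
    · intro hB
      obtain ⟨a, ha⟩ := P.nonempty_of_mem_parts hB
      exact ⟨a, P.part_eq_of_mem hB ha⟩
    · rintro ⟨a, rfl⟩
      exact P.part_mem.2 (Finset.mem_univ a)
  refine RiordanTree.ext (Finpartition.ext (Finset.ext fun B => ?_))
  simp only [hparts, hpart]

theorem RiordanTree.exists_rel_ne {n : ℕ} (T : RiordanTree n) (j : Fin n) :
    ∃ k, T.rel j k ∧ k ≠ j := by
  have h := T.two_le_card _ (T.partition.part_mem.2 (Finset.mem_univ j))
  obtain ⟨k, hk, hkj⟩ := Finset.exists_mem_ne h j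
  refine ⟨k, ?_, hkj⟩
  rw [Finpartition.mem_part_iff_part_eq_part _ (Finset.mem_univ _) (Finset.mem_univ _)] at hk
  exact hk.symm

theorem exists_riordanTree {n : ℕ} {r : Setoid (Fin n)} (hr : NonCrossing r)
    (h : ∀ j, ∃ k, r j k ∧ k ≠ j) : ∃ T : RiordanTree n, T.rel = r := by
  classical
  have hmem : ∀ a b, b ∈ (Finpartition.ofSetoid r).part a ↔ r a b := fun a b =>
    Finpartition.mem_part_ofSetoid_iff_rel
  have hpart : ∀ B ∈ (Finpartition.ofSetoid r).parts, ∀ a ∈ B,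
      (Finpartition.ofSetoid r).part a = B := fun B hB a ha =>
    Finpartition.part_eq_of_mem _ hB ha
  refine ⟨⟨Finpartition.ofSetoid r, fun B hB => ?_, fun A hA B hB hAB a ha b hb c hc d hd => ?_⟩,
    Setoid.ext fun a b => ?_⟩
  · obtain ⟨a, ha⟩ := Finpartition.nonempty_of_mem_parts _ hB
    obtain ⟨k, hk, hka⟩ := h a
    refine Finset.one_lt_card.2 ⟨a, ha, k, ?_, hka.symm⟩
    rw [← hpart B hB a ha, hmem]
    exact hk
  · rintro ⟨hab, hbc, hcd⟩
    refine hAB ?_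
    rw [← hpart A hA a ha, hmem] at hc
    rw [← hpart B hB b hb, hmem] at hd
    have := (hmem a b).2 (hr a b c d hab hbc hcd hc hd)
    rw [hpart A hA a ha] at this
    exact Finpartition.eq_of_mem_parts _ hA hB this hb
  · change (Finpartition.ofSetoid r).part a = (Finpartition.ofSetoid r).part b ↔ _
    rw [← Finpartition.mem_part_iff_part_eq_part _ (Finset.mem_univ _) (Finset.mem_univ _), hmem]
    exact ⟨r.symm', r.symm'⟩

instance finiteRiordanTree (n : ℕ) : Finite (RiordanTree n) :=
  Finite.of_injective _ (RiordanTree.rel_injective n)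

instance fintypeRiordanTree (n : ℕ) : Fintype (RiordanTree n) := Fintype.ofFinite _

instance fintypeFiner {n : ℕ} (T : RiordanTree n) :
    Fintype {T' : RiordanTree n // T'.rel < T.rel} := Fintype.ofFinite _

/-- A tree with projectors is the tree without them plus a combination of trees given by strictly
finer partitions. -/
theorem exists_f_eq {n : ℕ} (T : RiordanTree n) :
    ∃ c : {T' : RiordanTree n // T'.rel < T.rel} → Cq, f T = f₀ T + ∑ T', c T' • f₀ T'.1 := by
  classical
  suffices h : f T - f₀ T ∈ Submodule.span Cq
      (Set.range fun T' : {T' : RiordanTree n // T'.rel < T.rel} => f₀ T'.1) by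
    obtain ⟨c, hc⟩ := (Submodule.mem_span_range_iff_exists_fun Cq).1 h
    exact ⟨c, by rw [hc]; abel⟩
  obtain ⟨c, hc, hc1, hc2⟩ := exists_placeOn_linTree T
  -- The choice of `⊤` in every part is split off; it contributes `f₀ T` with coefficient 1.
  rw [f, hc, map_sum, ← Finset.add_sum_erase _ _ (Finset.mem_univ fun _ => ⊤), map_smul, hc1,
    one_smul, glue_top, ← RiordanTree.rel, ← f₀_eq, add_sub_cancel_left]
  refine Submodule.sum_mem _ fun p hp => ?_
  rw [map_smul]
  by_cases hcp : c p = 0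
  · rw [hcp, zero_smul]
    exact Submodule.zero_mem _
  refine Submodule.smul_mem _ _ ?_
  -- A refinement with a singleton dies under `π₂`; any other one is again the partition of a
  -- Riordan tree.
  by_cases hs : ∃ j, ∀ k, glue T.partition p j k → k = j
  · obtain ⟨j, hj⟩ := hs
    rw [boxes_eq_zero hj (coeff₁_diagram _)]
    exact Submodule.zero_mem _
  · push Not at hs
    obtain ⟨T', hT'⟩ := exists_riordanTree (hc2 p hcp) hs
    refine Submodule.subset_span ⟨⟨T', ?_⟩, ?_⟩
    · rw [hT', RiordanTree.rel]
      exact (glue_le p).lt_of_ne fun h => Finset.ne_of_mem_erase hp (eq_top_of_glue h)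
    · exact (f₀_eq T').trans (by rw [hT'])

theorem range_f₀ {n : ℕ} (h0 : ∀ T : RiordanTree n, f₀ T ≠ 0) :
    Set.range (f₀ (n := n)) = dualCanonical n := by
  ext y
  constructor
  · rintro ⟨T, rfl⟩
    obtain ⟨x, hx, h⟩ := exists_mem_dualCanonicalV1 T.nonCrossing_rel
    exact ⟨h0 T, x, hx, by rw [f₀_eq, eq_diagram h]⟩
  · rintro ⟨hy, x, hx, rfl⟩
    obtain ⟨r, hr, h⟩ := exists_diag_of_mem_dualCanonicalV1 x hx
    have hs : ∀ j, ∃ k, r j k ∧ k ≠ j := by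
      by_contra! hcon
      obtain ⟨j, hj⟩ := hcon
      exact hy (boxes_eq_zero hj h)
    obtain ⟨T, hT⟩ := exists_riordanTree hr hs
    exact ⟨T, by rw [f₀_eq, hT, eq_diagram h]⟩

/-! ### Linear algebra of triangular families -/

/-- In a relation, choose an index with nonzero coefficient and maximal key; its functional sees no
other term. A partial order of keys is enough. -/
theorem linearIndependent_of_triangular {ι K M α : Type*} [Fintype ι] [Field K]
    [AddCommMonoid M] [Module K M] [PartialOrder α] (v : ι → M) (φ : ι → M →ₗ[K] K) (key : ι → α)
    (hkey : Function.Injective key) (h1 : ∀ i, φ i (v i) ≠ 0)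
    (h2 : ∀ i j, φ j (v i) ≠ 0 → key j ≤ key i) : LinearIndependent K v := by
  classical
  -- Negation is multiplication by the scalar `-1`, so an additive monoid is enough.
  let _ : AddCommGroup M := Module.addCommMonoidToAddCommGroup K
  rw [Fintype.linearIndependent_iff]
  intro g hg
  by_contra! hne
  obtain ⟨i₀, hi₀⟩ := hne
  obtain ⟨i, hi⟩ := Finset.exists_maximalFor key (Finset.univ.filter fun i => g i ≠ 0)
    ⟨i₀, by simpa using hi₀⟩
  have hgi : g i ≠ 0 := by simpa using hi.1
  have h := congrArg (φ i) hg
  rw [map_sum, map_zero, Finset.sum_eq_single i] at h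
  · rw [map_smul, smul_eq_mul] at h
    exact mul_ne_zero hgi (h1 i) h
  · intro j _ hji
    rw [map_smul, smul_eq_mul]
    by_contra hne
    have hj := h2 j i (right_ne_zero_of_mul hne)
    have := hi.2 (by simpa using left_ne_zero_of_mul hne : j ∈ Finset.univ.filter fun i => g i ≠ 0) hj
    exact hji (hkey (le_antisymm this hj))
  · exact fun h => absurd (Finset.mem_univ i) h

/-- The jointly injective functionals bound the dimension above by the number of indices, and
independence bounds it below; spanning follows by comparison. -/
theorem exists_basis_of_linearIndependent {ι K M : Type*} [Fintype ι] [Field K] [AddCommMonoid M]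
    [Module K M] {v : ι → M} (hv : LinearIndependent K v) (φ : ι → M →ₗ[K] K)
    (hφ : ∀ x, (∀ i, φ i x = 0) → x = 0) : ∃ b : Module.Basis ι K M, ∀ i, b i = v i := by
  let _ : AddCommGroup M := Module.addCommMonoidToAddCommGroup K
  have hinj : Function.Injective (LinearMap.pi φ) := by
    rw [← LinearMap.ker_eq_bot, LinearMap.ker_eq_bot']
    exact fun x hx => hφ x fun i => congrFun hx i
  have : Module.Finite K M := Module.Finite.of_injective _ hinj
  have hcard : Fintype.card ι = Module.finrank K M := by
    refine le_antisymm hv.fintype_card_le_finrank ?_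
    have h := LinearMap.finrank_le_finrank_of_injective hinj
    rwa [Module.finrank_fintype_fun_eq_card] at h
  exact ⟨Module.Basis.mk hv (hv.span_eq_top_of_card_eq_finrank' hcard).ge,
    fun i => Module.Basis.mk_apply _ _ i⟩

/-! ### Leading words of Riordan trees -/

/-- The leading word of the diagram of a Riordan tree. -/
def RiordanTree.lead {n : ℕ} (T : RiordanTree n) : ℕ → Fin 2 := (exists_isLead T.rel).choose

theorem RiordanTree.isLead_lead {n : ℕ} (T : RiordanTree n) : IsLead T.rel T.lead :=
  (exists_isLead T.rel).choose_spec

theorem IsLead.eq {n : ℕ} {r : Setoid (Fin n)} {s u : ℕ → Fin 2} (hs : IsLead r s)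
    (hu : IsLead r u) : ∀ i < 2 * n, s i = u i := by
  have h01 : ∀ a b : Fin 2, (a = 0 ↔ b = 0) → a = b := by decide
  intro i hi
  obtain ⟨j, rfl | rfl⟩ : ∃ j, i = 2 * j ∨ i = 2 * j + 1 := ⟨i / 2, by omega⟩
  · exact h01 _ _ ((hs ⟨j, by omega⟩).1.trans (hu ⟨j, by omega⟩).1.symm)
  · exact h01 _ _ ((hs ⟨j, by omega⟩).2.trans (hu ⟨j, by omega⟩).2.symm)

theorem IsLead.eq_of_pair {n : ℕ} {r : Setoid (Fin n)} {u : ℕ → Fin 2} (hu : IsLead r u)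
    {j : Fin n} (h0 : u (2 * j) = 0) (h1 : u (2 * j + 1) = 1) {k : Fin n} (hk : r j k) : k = j := by
  refine le_antisymm (not_lt.1 fun hjk => ?_) ((hu j).1.1 h0 k hk)
  rw [(hu j).2.2 ⟨k, hk, hjk⟩] at h1
  exact zero_ne_one h1

/-- Up-down at a box would make it a singleton, which a tree excludes. This is the hypothesis of
`height_le_of_wordOf`. -/
theorem RiordanTree.lead_pair {n : ℕ} (T : RiordanTree n) :
    ∀ i < n, ¬ (T.lead (2 * i) = 0 ∧ T.lead (2 * i + 1) = 1) := by
  rintro i hi ⟨h0, h1⟩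
  obtain ⟨k, hk, hne⟩ := T.exists_rel_ne ⟨i, hi⟩
  exact hne (T.isLead_lead.eq_of_pair (j := ⟨i, hi⟩) h0 h1 hk)

/-- The heights of the leading word of a Riordan tree. -/
def RiordanTree.heights {n : ℕ} (T : RiordanTree n) (k : Fin (2 * n + 1)) : ℤ := height T.lead k

theorem RiordanTree.heights_injective (n : ℕ) :
    Function.Injective (RiordanTree.heights : RiordanTree n → Fin (2 * n + 1) → ℤ) := by
  intro T T' h
  refine RiordanTree.rel_injective n
    (T.isLead_lead.unique T.nonCrossing_rel T'.nonCrossing_rel _ (T'.isLead_lead.congr ?_))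
  refine eq_of_height_eq fun k hk => ?_
  exact (congrFun h ⟨k, by omega⟩).symm

theorem f₀_mem_Inv {n : ℕ} (T : RiordanTree n) : f₀ T ∈ Inv n := by
  rw [f₀_eq]
  exact boxes_mem_Inv T.nonCrossing_rel (coeff₁_diagram _)

theorem coeff₂_f₀_ne_zero {n : ℕ} (T : RiordanTree n) : coeff₂ n (wordOf T.lead) (f₀ T) ≠ 0 := by
  rw [f₀_eq]
  exact coeff₂_boxes_ne_zero T.nonCrossing_rel (coeff₁_diagram _) T.isLead_lead T.lead_pair

/-- The coefficient of an invariant at the leading word of a tree. -/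
def leadCoeff {n : ℕ} (T : RiordanTree n) : Inv n →ₗ[Cq] Cq :=
  coeff₂ n (wordOf T.lead) ∘ₗ (Inv n).subtype

/-- Triangularity holds for the pointwise order on height functions. -/
theorem linearIndependent_f₀ (n : ℕ) :
    LinearIndependent Cq fun T : RiordanTree n => (⟨f₀ T, f₀_mem_Inv T⟩ : Inv n) := by
  refine linearIndependent_of_triangular _ leadCoeff RiordanTree.heights
    (RiordanTree.heights_injective n) coeff₂_f₀_ne_zero fun T T' h k => ?_
  change coeff₂ n (wordOf T'.lead) (f₀ T) ≠ 0 at h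
  rw [f₀_eq] at h
  exact height_le_of_coeff₂_ne_zero T.nonCrossing_rel (coeff₁_diagram _) T.isLead_lead T'.lead_pair h
    k (by omega)

/-! ### Paths and trees -/

/-- The word for `V₁^{⊗2n}` that corresponds to a path. -/
def pathWord (w : ℕ → Fin 3) (t : ℕ) : Fin 2 :=
  if t % 2 = 0 then if w (t / 2) = 0 then 0 else 1 else if w (t / 2) = 2 then 1 else 0

theorem pathWord_two_mul (w : ℕ → Fin 3) (i : ℕ) :
    pathWord w (2 * i) = if w i = 0 then 0 else 1 := by
  simp [pathWord]

theorem pathWord_two_mul_add_one (w : ℕ → Fin 3) (i : ℕ) :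
    pathWord w (2 * i + 1) = if w i = 2 then 1 else 0 := by
  have h1 : (2 * i + 1) % 2 = 1 := by omega
  have h2 : (2 * i + 1) / 2 = i := by omega
  simp [pathWord, h1, h2]

theorem wordOf_pathWord (w : ℕ → Fin 3) : wordOf (pathWord w) = w := by
  funext i
  rw [wordOf, pathWord_two_mul, pathWord_two_mul_add_one]
  generalize w i = a
  fin_cases a <;> simp [letter]

/-- A flat step is read as down-up; it stays nonnegative exactly because it does not occur at height
0. -/
theorem height_pathWord {n k : ℕ} {w : ℕ → Fin 3} (h : IsRiordanPath n w k) :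
    height (pathWord w) (2 * n) = 2 * k ∧ ∀ t ≤ 2 * n, 0 ≤ height (pathWord w) t := by
  induction n generalizing k with
  | zero =>
    obtain rfl : k = 0 := h
    refine ⟨rfl, fun t ht => ?_⟩
    obtain rfl : t = 0 := by omega
    exact le_rfl
  | succ n ih =>
    suffices H : height (pathWord w) (2 * n + 2) = 2 * k ∧
        (0 ≤ height (pathWord w) (2 * n + 1)) ∧ ∀ t ≤ 2 * n, 0 ≤ height (pathWord w) t by
      refine ⟨H.1, fun t ht => ?_⟩
      rcases Nat.lt_or_ge (2 * n) t with h1 | h1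
      · obtain rfl | rfl : t = 2 * n + 1 ∨ t = 2 * n + 2 := by omega
        · exact H.2.1
        · rw [H.1]
          positivity
      · exact H.2.2 t h1
    rw [height_succ _ (2 * n + 1), height_succ, pathWord_two_mul, pathWord_two_mul_add_one]
    simp only [IsRiordanPath] at h
    split at h <;> rename_i hw
    · obtain ⟨k', rfl, h⟩ := h
      obtain ⟨h1, h2⟩ := ih h
      rw [hw, h1]
      refine ⟨?_, ?_, h2⟩ <;> simp <;> omega
    · obtain ⟨h1, h2⟩ := ih h.2
      have := h.1
      rw [hw, h1]
      refine ⟨?_, ?_, h2⟩ <;> simp <;> omega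
    · obtain ⟨h1, h2⟩ := ih h
      rw [hw, h1]
      refine ⟨?_, ?_, h2⟩ <;> simp <;> omega

/-- The path gives a ballot word, hence a noncrossing partition. As flat steps are down-up, no box
reads up-down, so there are no singletons. -/
theorem exists_riordanTree_of_path {n : ℕ} {w : ℕ → Fin 3} (h : IsRiordanPath n w 0) :
    ∃ T : RiordanTree n, ∀ i < n, wordOf T.lead i = w i := by
  obtain ⟨h0, hpos⟩ := height_pathWord h
  obtain ⟨r, hr, hlead⟩ := exists_isLead_of_ballot (pathWord w) hpos (by simpa using h0)
  have hs : ∀ j, ∃ k, r j k ∧ k ≠ j := by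
    by_contra! hcon
    obtain ⟨j, hj⟩ := hcon
    have h1 := (hlead j).1.2 fun k hk => (hj k hk).ge
    have h2 : ¬ pathWord w (2 * j + 1) = 0 := by
      rw [(hlead j).2]
      rintro ⟨k, hk, hjk⟩
      exact hjk.ne (hj k hk).symm
    rw [pathWord_two_mul] at h1
    rw [pathWord_two_mul_add_one] at h2
    generalize w j = a at h1 h2
    fin_cases a <;> simp at h1 h2
  obtain ⟨T, rfl⟩ := exists_riordanTree hr hs
  refine ⟨T, fun i hi => ?_⟩
  have h3 := T.isLead_lead.eq hlead
  rw [wordOf, h3 _ (by omega), h3 _ (by omega)]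
  exact congrFun (wordOf_pathWord w) i

theorem eq_zero_of_leadCoeff {n : ℕ} (x : Inv n) (h : ∀ T, leadCoeff T x = 0) : x = 0 := by
  obtain ⟨hE, hK⟩ := mem_Inv_iff.1 x.2
  refine Subtype.ext (eq_zero_of_coeff₂ (k := 0) hE (by simpa using hK) fun w hw => ?_)
  obtain ⟨T, hT⟩ := exists_riordanTree_of_path hw
  rw [← coeff₂_congr hT]
  exact h T

/-- The elements `f₀ T` form the dual canonical basis, and the `f T` form a basis that is unitriangular
with respect to it. -/
theorem exists_bases (n : ℕ) :
    ∃ (b₀ b : Module.Basis (RiordanTree n) Cq (Inv n)),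
      (∀ T, (b₀ T : V2Pow n) = f₀ T) ∧
      Set.range (f₀ (n := n)) = dualCanonical n ∧
      (∀ T, (b T : V2Pow n) = f T) ∧
      ∃ _ : LinearOrder (RiordanTree n),
        (∀ T, b₀.repr (b T) T = 1) ∧ ∀ T T', T < T' → b₀.repr (b T) T' = 0 := by
  classical
  obtain ⟨b₀, hb₀⟩ := exists_basis_of_linearIndependent (linearIndependent_f₀ n) leadCoeff
    eq_zero_of_leadCoeff
  choose c hc using fun T : RiordanTree n => exists_f_eq T
  -- This is `f T`, written so that membership in the invariants and the coordinates in `b₀` are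
  -- immediate.
  let v : RiordanTree n → Inv n := fun T => b₀ T + ∑ T', c T T' • b₀ T'.1
  have hv : ∀ T, (v T : V2Pow n) = f T := by
    intro T
    simp [v, hb₀, hc T]
  have hrepr : ∀ T T', b₀.repr (v T) T' ≠ 0 → T' = T ∨ T'.rel < T.rel := by
    intro T T' h
    by_contra! hcon
    refine h ?_
    simp only [v, map_add, map_sum, map_smul, Module.Basis.repr_self, Finsupp.add_apply,
      Finsupp.finsetSum_apply, Finsupp.smul_apply]
    rw [Finsupp.single_eq_of_ne hcon.1, zero_add]
    refine Finset.sum_eq_zero fun S _ => ?_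
    rw [Finsupp.single_eq_of_ne, smul_zero]
    rintro rfl
    exact hcon.2 S.2
  have hone : ∀ T, b₀.repr (v T) T = 1 := by
    intro T
    simp only [v, map_add, map_sum, map_smul, Module.Basis.repr_self, Finsupp.add_apply,
      Finsupp.finsetSum_apply, Finsupp.smul_apply]
    rw [Finsupp.single_eq_same, Finset.sum_eq_zero, add_zero]
    intro S _
    rw [Finsupp.single_eq_of_ne, smul_zero]
    intro h
    exact S.2.ne (h ▸ rfl)
  -- The dual coordinates of `b₀` serve as functionals, with refinement of partitions as the order
  -- of keys.
  have hli : LinearIndependent Cq v :=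
    linearIndependent_of_triangular v b₀.coord RiordanTree.rel (RiordanTree.rel_injective n)
      (fun T => by rw [Module.Basis.coord_apply, hone]; exact one_ne_zero)
      fun T T' h => (hrepr T T' h).elim (fun h => h ▸ le_rfl) le_of_lt
  obtain ⟨b, hb⟩ := exists_basis_of_linearIndependent hli leadCoeff eq_zero_of_leadCoeff
  refine ⟨b₀, b, fun T => by rw [hb₀], ?_, fun T => by rw [hb, hv], ?_⟩
  · exact range_f₀ fun T h => coeff₂_f₀_ne_zero T (by rw [h, map_zero])
  · let _ : PartialOrder (RiordanTree n) :=
      PartialOrder.lift RiordanTree.rel (RiordanTree.rel_injective n)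
    refine ⟨LinearOrder.lift' (toLinearExtension (α := RiordanTree n)) fun _ _ h => h,
      fun T => by rw [hb, hone], fun T T' h => ?_⟩
    rw [hb]
    by_contra hne
    have hle : T' ≤ T := by
      rcases hrepr T T' hne with rfl | h'
      · exact le_rfl
      · exact le_of_lt (α := Setoid (Fin n)) h'
    exact absurd (toLinearExtension.monotone hle) (not_le.2 h)

end

end QuantumTree

theorem theorem4p2 (n : ℕ) :
    ∃ (b₀ b : Module.Basis (QuantumTree.RiordanTree n) QuantumTree.Cq (QuantumTree.Inv n)),
      (∀ T, (b₀ T : QuantumTree.V2Pow n) = QuantumTree.f₀ T) ∧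
      Set.range (QuantumTree.f₀ (n := n)) = QuantumTree.dualCanonical n ∧
      (∀ T, (b T : QuantumTree.V2Pow n) = QuantumTree.f T) ∧
      ∃ _ : LinearOrder (QuantumTree.RiordanTree n),
        (∀ T, b₀.repr (b T) T = 1) ∧ ∀ T T', T < T' → b₀.repr (b T) T' = 0 :=
  QuantumTree.exists_bases n
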